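/- Let $n\ge 1$ and $2\le k\le\infty$. Let $Y$ be a smooth $(n+1)$-manifold with boundary $X^n=\partial Y$, and let $g_0=-dt^2+d\sigma_0$ on $\mathbb R\times S^{n-1}$, where $d\sigma_0$ is the unit round metric. A defining function is a function that is positive on the interior, zero on $\partial Y$, and has nonzero differential along $\partial Y$. A Lorentz metric $g$ on the interior of $Y$ is called asymptotically AdS if there is a $C^k$ defining function $\Omega$ of $\partial Y$ such that 1. $\Omega^2 g$ extends to a $C^k$ Lorentz metric on $Y$ (up to and including the boundary); 2. $R_{ab}-\tfrac12 Rg_{ab}+\Lambda g_{ab}=8\pi G\,T_{ab}$ in the interior, with $\Lambda=-\tfrac{n(n-1)}2$ and $G>0$ a constant, where $\Omega^{-n}T_{ab}$ extends to a $C^k$ tensor field on $Y$; 3. there is a $C^k$ diffeomorphism of $\mathbb R\times S^{n-1}$ onto $\partial Y$ which is conformal from $g_0$ to $\Omega^2g|_{T\partial Y}$ (with a positive conformal factor). Let $(Y,g)$ be asymptotically AdS. Let $s$ be a special defining function: $s$ is a $C^1$ defining function on a neighbourhood $U$ of $\partial Y$, $s^2g$ extends to a $C^1$ Lorentz metric on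 $U$ up to the boundary, $|ds|_{s^2g}=1$ on $U$, and $s^2g|_{T\partial Y}=-dt^2+d\sigma_0$ under a $C^1$ diffeomorphism $\psi:\mathbb R\times S^{n-1}\to\partial Y$. Let $(s,t,\theta)$ be special boundary coordinates, that is, a $C^2$ diffeomorphism $\Phi$ of a collar $$C=\{(s,t,\theta)\in[0,\infty)\times\mathbb R\times S^{n-1}:\ 0\le s<\varepsilon(t,\theta)\},\qquad \varepsilon>0\ \text{continuous},$$ (for example $[0,\varepsilon)\times\mathbb R\times S^{n-1}$) onto an open neighbourhood of $\partial Y$ contained in $U$, whose first coordinate is the function $s$, with $\Phi(0,t,\theta)=\psi(t,\theta)$, in which $$s^2g=ds^2+g_s,$$ where $g_s$ is the restriction of (the extension of) $s^2g$ to the slices of constant $s$. Let $X$ be a $C^1$ Killing field of $g$ on the interior of $Y$ which approaches $\partial_t$ at infinity: at each boundary point, $X$ extends continuously, as a vector field on $Y$, by $\partial_t=d\psi(\partial_t)$. Then, on this tubular neighbourhood of the boundary, - $X=\dfrac{\partial}{\partial t}$ at every point of $C$ with $s>0$; - $g_s$ is independent of $t$: $g_s(t,\theta)=g_s(t',\theta)$,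 in the coordinates $(t,\theta)$, whenever the segment from $(s,t,\theta)$ to $(s,t',\theta)$ lies in $C$ (for $C=[0,\varepsilon)\times\mathbb R\times S^{n-1}$ with $\varepsilon$ constant, this holds for all $t$, $t'$). -/

import Mathlib

open Set Filter Topology Metric Module
open scoped Manifold ContDiff Matrix

noncomputable section

namespace AdS

/-! Throughout `n = m + 1`: the space-time `Y` has dimension `n + 1 = m + 2`, and its boundary at
infinity is the cylinder `ℝ × S^{n-1} = ℝ × S^m`. -/

/-- The model vector space of the space-time. -/
abbrev E (m : ℕ) := EuclideanSpace ℝ (Fin (m + 2))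

/-- The model with corners of the space-time (a manifold with boundary). -/
abbrev I (m : ℕ) : ModelWithCorners ℝ (E m) (EuclideanHalfSpace (m + 2)) := 𝓡∂ (m + 2)

/-- The unit sphere `S^{n-1}` in `ℝⁿ`. -/
abbrev Sph (m : ℕ) := sphere (0 : EuclideanSpace ℝ (Fin (m + 1))) 1

/-- Tangent vectors of `ℝ × S^{n-1}`, as pairs `(∂_t`-component, spherical part`)`. -/
abbrev BVec (m : ℕ) := ℝ × EuclideanSpace ℝ (Fin m)

/-- The model with corners of `ℝ × S^{n-1}`; points are `(t, θ)`. -/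
abbrev J (m : ℕ) := (𝓘(ℝ, ℝ)).prod (𝓡 m)

/-- The model with corners of `ℝ × (ℝ × S^{n-1})`; points are `(s, t, θ)`. -/
abbrev JC (m : ℕ) := (𝓘(ℝ, ℝ)).prod (J m)

/-- The derivative at `θ` of the inclusion of the sphere in Euclidean space. -/
def sphIncl {m : ℕ} (θ : Sph m) :
    EuclideanSpace ℝ (Fin m) →L[ℝ] EuclideanSpace ℝ (Fin (m + 1)) :=
  mfderiv (𝓡 m) 𝓘(ℝ, EuclideanSpace ℝ (Fin (m + 1)))
    (fun x : Sph m => (x : EuclideanSpace ℝ (Fin (m + 1)))) θ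

/-- The metric `g₀ = -dt² + dσ₀` on `ℝ × S^{n-1}`, where `dσ₀` is the unit round metric, that is,
the metric induced by the inclusion of the sphere in Euclidean space. -/
def g0 {m : ℕ} (p : ℝ × Sph m) (v w : BVec m) : ℝ :=
  -(v.1 * w.1) + inner ℝ (sphIncl p.2 v.2) (sphIncl p.2 w.2)

/-- A bilinear form of Lorentzian signature `(-,+,…,+)`: symmetric, with a timelike vector on whose
orthogonal complement the form is positive definite. -/
def IsLorentz {V : Type*} [AddCommGroup V] [Module ℝ V] [TopologicalSpace V]
    [IsTopologicalAddGroup V] [ContinuousConstSMul ℝ V] (B : V →L[ℝ] V →L[ℝ] ℝ) : Prop :=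
  (∀ v w, B v w = B w v) ∧ ∃ v, B v v < 0 ∧ ∀ w, B v w = 0 → w ≠ 0 → 0 < B w w

/-- The covector `l` has `|l|²_B = c`: the vector `v` dual to `l` (its gradient) has `l v = c`.
Used for nondegenerate `B` only, where `v` is unique. -/
def HasCovectorNormSq {V : Type*} [AddCommGroup V] [Module ℝ V] [TopologicalSpace V]
    [IsTopologicalAddGroup V] [ContinuousConstSMul ℝ V]
    (B : V →L[ℝ] V →L[ℝ] ℝ) (l : V →L[ℝ] ℝ) (c : ℝ) : Prop :=
  ∃ v, B v = l ∧ l v = c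

section Spacetime

variable {m : ℕ} {Y : Type*} [TopologicalSpace Y] [ChartedSpace (EuclideanHalfSpace (m + 2)) Y]

variable (m Y) in
/-- Fields of bilinear forms on the tangent spaces of `Y`. -/
abbrev BilinField :=
  ∀ x : Y, TangentSpace (I m) x →L[ℝ] TangentSpace (I m) x →L[ℝ] ℝ

/-- `B` is of class `C^k` on `U`. -/
def BilinField.CkOn [IsManifold (I m) ∞ Y] (B : BilinField m Y) (k : ℕ∞) (U : Set Y) : Prop :=
  ContMDiffOn (I m) ((I m).prod 𝓘(ℝ, E m →L[ℝ] E m →L[ℝ] ℝ)) k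
    (fun x => Bundle.TotalSpace.mk' (E m →L[ℝ] E m →L[ℝ] ℝ)
      (E := fun x : Y => TangentSpace (I m) x →L[ℝ] TangentSpace (I m) x →L[ℝ] ℝ) x (B x)) U

/-! ### Curvature and the Einstein equation -/

/-- The components `B_{ij}` at the coordinate point `y`, in the preferred chart around `x`. -/
def coordMatrix (B : BilinField m Y) (x : Y) (y : E m) : Matrix (Fin (m + 2)) (Fin (m + 2)) ℝ :=
  Matrix.of fun i j =>
    B ((extChartAt (I m) x).symm y)
      (mfderivWithin 𝓘(ℝ, E m) (I m) (extChartAt (I m) x).symm (range (I m)) y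
        (EuclideanSpace.single i (1 : ℝ) : E m))
      (mfderivWithin 𝓘(ℝ, E m) (I m) (extChartAt (I m) x).symm (range (I m)) y
        (EuclideanSpace.single j (1 : ℝ) : E m))

/-- The partial derivative `∂_i f` at `y`. -/
def pd (i : Fin (m + 2)) (f : E m → ℝ) (y : E m) : ℝ :=
  fderiv ℝ f y (EuclideanSpace.single i (1 : ℝ))

/-- The Christoffel symbol `Γ^k_{ij} = ½ G^{kl} (∂_i G_{jl} + ∂_j G_{il} - ∂_l G_{ij})`. -/
def christoffel (G : E m → Matrix (Fin (m + 2)) (Fin (m + 2)) ℝ) (k i j : Fin (m + 2))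
    (y : E m) : ℝ :=
  (1 / 2 : ℝ) * ∑ l, (G y)⁻¹ k l *
    (pd i (fun z => G z j l) y + pd j (fun z => G z i l) y - pd l (fun z => G z i j) y)

/-- The Ricci tensor
`R_{ij} = ∂_k Γ^k_{ij} - ∂_j Γ^k_{ik} + Γ^k_{kl} Γ^l_{ij} - Γ^k_{jl} Γ^l_{ik}`. -/
def ricci (G : E m → Matrix (Fin (m + 2)) (Fin (m + 2)) ℝ) (y : E m) :
    Matrix (Fin (m + 2)) (Fin (m + 2)) ℝ :=
  Matrix.of fun i j =>
    ∑ k, (pd k (christoffel G k i j) y - pd j (christoffel G k i k) y) +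
      ∑ k, ∑ l, (christoffel G k k l y * christoffel G l i j y
        - christoffel G k j l y * christoffel G l i k y)

/-- The scalar curvature `R = G^{ij} R_{ij}`. -/
def scalarCurv (G : E m → Matrix (Fin (m + 2)) (Fin (m + 2)) ℝ) (y : E m) : ℝ :=
  ∑ i, ∑ j, (G y)⁻¹ i j * ricci G y i j

/-- The Einstein equation `R_{ab} - ½ R g_{ab} + Λ g_{ab} = 8πκ T_{ab}` at `x`, with Newton's
constant `κ`, in the preferred coordinates around `x`. -/
def EinsteinAt (Λ κ : ℝ) (g T : BilinField m Y) (x : Y) : Prop :=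
  ricci (coordMatrix g x) (extChartAt (I m) x x)
      - ((1 / 2 : ℝ) * scalarCurv (coordMatrix g x) (extChartAt (I m) x x)) •
        coordMatrix g x (extChartAt (I m) x x)
      + Λ • coordMatrix g x (extChartAt (I m) x x)
    = (8 * Real.pi * κ) • coordMatrix T x (extChartAt (I m) x x)

/-! ### Conformal completions -/

variable [IsManifold (I m) ∞ Y]

variable (m) in
/-- `ρ` is a `C^k` defining function of the boundary of `Y`, on the open neighbourhood `U` of it. -/
structure IsDefiningFunctionOn (k : ℕ∞) (U : Set Y) (ρ : Y → ℝ) : Prop where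
  isOpen : IsOpen U
  boundary_subset : (I m).boundary Y ⊆ U
  contMDiffOn : ContMDiffOn (I m) 𝓘(ℝ, ℝ) k ρ U
  pos : ∀ x ∈ U ∩ (I m).interior Y, 0 < ρ x
  zero : ∀ x ∈ (I m).boundary Y, ρ x = 0
  d_ne_zero : ∀ x ∈ (I m).boundary Y, mfderiv (I m) 𝓘(ℝ, ℝ) ρ x ≠ 0

/-- `gbar` is a Lorentz metric of class `C^k` on `U`, up to the boundary, that extends `ρ² g`.
Here `g` matters at interior points only. -/
structure IsConformalExtensionOn (k : ℕ∞) (U : Set Y) (g : BilinField m Y) (ρ : Y → ℝ)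
    (gbar : BilinField m Y) : Prop where
  ck : gbar.CkOn k U
  lorentz : ∀ x ∈ U, IsLorentz (gbar x)
  eq : ∀ x ∈ U ∩ (I m).interior Y, gbar x = (ρ x ^ 2) • g x

/-- `ψ` is a `C^k` diffeomorphism of `ℝ × S^{n-1}` onto the boundary of `Y`. -/
structure IsBoundaryIdentification (k : ℕ∞) (ψ : ℝ × Sph m → Y) : Prop where
  contMDiff : ContMDiff (J m) (I m) k ψ
  isEmbedding : IsEmbedding ψ
  immersion : ∀ p, Function.Injective (mfderiv (J m) (I m) ψ p)
  range_eq : range ψ = (I m).boundary Y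

/-- The restriction of `B` to the boundary, as a form on `ℝ × S^{n-1}`: `(ψ^* B)_p(v, w)`. -/
def boundaryPullback (B : BilinField m Y) (ψ : ℝ × Sph m → Y) (p : ℝ × Sph m)
    (v w : BVec m) : ℝ :=
  B (ψ p) (mfderiv (J m) (I m) ψ p v) (mfderiv (J m) (I m) ψ p w)

/-- `(Y, g)` is an asymptotically AdS space-time of dimension `n + 1` with a `C^k` conformal
completion. The metric `g` lives on the interior of the manifold with boundary `Y`; the
cosmological constant is `Λ = -n(n-1)/2`, and Newton's constant is `κ`. -/
def IsAsymptoticallyAdS (k : ℕ∞) (κ : ℝ) (g : BilinField m Y) : Prop :=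
  ∃ (Ω : Y → ℝ) (gbar : BilinField m Y),
    -- the conformal completion
    IsDefiningFunctionOn m k univ Ω ∧ IsConformalExtensionOn k univ g Ω gbar ∧
    -- the Einstein equation, with `Ω^{-n} T` extending to the boundary
    (∃ T τ : BilinField m Y,
      (∀ x ∈ (I m).interior Y, EinsteinAt (-(((m : ℝ) + 1) * m) / 2) κ g T x) ∧
      τ.CkOn k univ ∧ ∀ x ∈ (I m).interior Y, T x = (Ω x ^ (m + 1)) • τ x) ∧
    -- the boundary is diffeomorphic to `ℝ × S^{n-1}`, and conformal to `(ℝ × S^{n-1}, g₀)`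
    ∃ (ψ : ℝ × Sph m → Y) (lam : ℝ × Sph m → ℝ), IsBoundaryIdentification k ψ ∧
      ∀ p, 0 < lam p ∧ ∀ v w, boundaryPullback gbar ψ p v w = lam p * g0 p v w

/-- `s` is the special defining function, on the neighbourhood `U` of the boundary, for the
identification `ψ` of the boundary with `ℝ × S^{n-1}`: `gbar = s² g` extends to the boundary,
`s² g |_{TX} = -dt² + dσ₀`, and `|ds|_{s² g} = 1`. -/
structure IsSpecialDefiningFunction (g : BilinField m Y) (ψ : ℝ × Sph m → Y) (U : Set Y)
    (s : Y → ℝ) (gbar : BilinField m Y) : Prop where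
  defining : IsDefiningFunctionOn m 1 U s
  extension : IsConformalExtensionOn 1 U g s gbar
  boundary_metric : ∀ p v w, boundaryPullback gbar ψ p v w = g0 p v w
  unit : ∀ x ∈ U, HasCovectorNormSq (gbar x) (mfderiv (I m) 𝓘(ℝ, ℝ) s x) 1

/-! ### Special boundary coordinates -/

/-- The collar `{(s, t, θ) : 0 ≤ s < ε(t, θ)}`. -/
def collar (ε : ℝ × Sph m → ℝ) : Set (ℝ × (ℝ × Sph m)) := {q | 0 ≤ q.1 ∧ q.1 < ε q.2}

/-- The coordinate vector field (or any vector with constant components) `v` at the point of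
coordinates `q`, seen as a tangent vector of `Y`. -/
def push (Φ : ℝ × (ℝ × Sph m) → Y) (ε : ℝ × Sph m → ℝ) (q : ℝ × (ℝ × Sph m))
    (v : ℝ × BVec m) : TangentSpace (I m) (Φ q) :=
  mfderivWithin (JC m) (I m) Φ (collar ε) q v

/-- The metric `g_s` at `(t, θ)`, for `q = (s, t, θ)`: the restriction of `gbar = s² g` to the
slice of constant `s`. -/
def sliceMetric (gbar : BilinField m Y) (Φ : ℝ × (ℝ × Sph m) → Y) (ε : ℝ × Sph m → ℝ)
    (q : ℝ × (ℝ × Sph m)) (v w : BVec m) : ℝ :=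
  gbar (Φ q) (push Φ ε q (0, v)) (push Φ ε q (0, w))

/-- `Φ` gives the special boundary coordinates `(s, t, θ)` on a tubular neighbourhood of the
boundary: it is a diffeomorphism of a collar onto an open neighbourhood of the boundary, its first
coordinate is `s`, it restricts to `ψ` on the boundary, and `s² g = ds² + g_s`. -/
structure IsSpecialCoordinates (ψ : ℝ × Sph m → Y) (U : Set Y) (s : Y → ℝ)
    (gbar : BilinField m Y) (ε : ℝ × Sph m → ℝ) (Φ : PartialEquiv (ℝ × (ℝ × Sph m)) Y) :
    Prop where
  eps_continuous : Continuous ε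
  eps_pos : ∀ p, 0 < ε p
  source_eq : Φ.source = collar ε
  target_open : IsOpen Φ.target
  target_subset : Φ.target ⊆ U
  contMDiffOn : ContMDiffOn (JC m) (I m) 2 Φ Φ.source
  contMDiffOn_symm : ContMDiffOn (I m) (JC m) 2 Φ.symm Φ.target
  fst_eq : ∀ q ∈ collar ε, s (Φ q) = q.1
  boundary_eq : ∀ p, Φ (0, p) = ψ p
  metric_eq : ∀ q ∈ collar ε, ∀ v w : ℝ × BVec m,
    gbar (Φ q) (push Φ ε q v) (push Φ ε q w) = v.1 * w.1 + sliceMetric gbar Φ ε q v.2 w.2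

/-! ### Killing fields -/

/-- `X` is a (`C^1`) Killing field of `g` on the interior of `Y`: `L_X g = 0`, that is,
`X (g(V, W)) = g([X, V], W) + g(V, [X, W])` for all vector fields `V`, `W`. -/
structure IsKillingField (g : BilinField m Y) (X : ∀ x : Y, TangentSpace (I m) x) : Prop where
  contMDiffOn : ContMDiffOn (I m) (I m).tangent 1
    (fun x => (⟨x, X x⟩ : TangentBundle (I m) Y)) ((I m).interior Y)
  lie_eq_zero : ∀ x ∈ (I m).interior Y, ∀ V W : (∀ y : Y, TangentSpace (I m) y),
    MDifferentiableAt (I m) (I m).tangent (fun y => (⟨y, V y⟩ : TangentBundle (I m) Y)) x →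
    MDifferentiableAt (I m) (I m).tangent (fun y => (⟨y, W y⟩ : TangentBundle (I m) Y)) x →
    (mfderiv (I m) 𝓘(ℝ, ℝ) (fun y => g y (V y) (W y)) x (X x) : ℝ) =
      g x (VectorField.mlieBracket (I m) X V x) (W x) +
        g x (V x) (VectorField.mlieBracket (I m) X W x)

/-- `X` approaches `∂_t` at infinity: extended by the coordinate field `∂_t` of `ℝ × S^{n-1}` it
is continuous at the points of the boundary. -/
def ApproachesTimeTranslation (ψ : ℝ × Sph m → Y) (X : ∀ x : Y, TangentSpace (I m) x) : Prop :=
  ∀ p : ℝ × Sph m,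
    Tendsto (fun x => (⟨x, X x⟩ : TangentBundle (I m) Y)) (𝓝[(I m).interior Y] (ψ p))
      (𝓝 ⟨ψ p, mfderiv (J m) (I m) ψ p ((1, 0) : BVec m)⟩)

end Spacetime

end AdS

end

open AdS

/-!
Why the theorem holds. In the coordinates `(s, t, θ)`, with `B = s² g = ds² + g_s`, the Killing
equation for `g = s⁻² B` reads `L_X B = 2 (X^s / s) B`; this is `killing_coordForm`.

* Its `(s, s)` component is `∂_s X^s = X^s / s`, so `X^s = c s` with `c` independent of `s`
  (`IsCollarKilling.fst_div_eq`).
* Its `(t, t)` component expresses `∂_t (B(∂_t, X))` through `X`, `c`, `B` and the first derivatives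
  of `B`, all of which have limits at the boundary: there `X = ∂_t`, and `B(∂_t, ∂_t) = -1` is
  constant, so `∂_t (B(∂_t, X)) → -c`. Since `B(∂_t, X)` itself tends to the constant `-1`,
  the mean value theorem on short `t`-intervals gives `c = 0` (`eq_zero_of_tendsto_deriv`,
  `IsCollarKilling.fst_eq_zero`). Neither a second derivative of `c` nor a derivative of `X` at the
  boundary enters, so that `C^1` regularity of `B` up to the boundary is enough.
* With `X^s = 0`, the `(s, A)` components say `B(∂_s X, ∂_A) = 0`, and `B` is nondegenerate: `X` is
  constant along the lines of constant `(t, θ)`, hence equal to its limit `∂_t`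
  (`IsCollarKilling.eq_dt`).
* With `X = ∂_t`, the equation says `∂_t B = 0` (`IsCollarKilling.form_eq`).

This argument is carried out on an open subset of a vector space, `z` being coordinates on the
sphere around a given point `θ₀`; it only differentiates `B` and `X` there, and compares values
along lines on which `z` is constant. The Killing equation is transported from `Y` by the naturality
of the Lie bracket (`IsParametrization.killing_eq`), and the behaviour of `X` at infinity by the
continuity of the tangent map of the coordinates
(`AdS.IsSpecialCoordinates.tendsto_coordField`). The slice `s = 0` carries the metric `g0`, which
does not involve `t`.
-/

-- Instances on the space of continuous trilinear maps are not found with a smaller depth.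
set_option maxSynthPendingDepth 3
set_option linter.unusedSectionVars false

/-! ### Analysis on a collar in a vector space -/

/-- If `∂_t f(s, t) → L` as `(s, t) → (0⁺, t₀)`, while `f(s, t)` tends to a constant independent of
`t` as `s → 0⁺`, then `L = 0`. No convergence of `∂_t f` away from `(0, t₀)` is needed. -/
lemma eq_zero_of_tendsto_deriv {f f' : ℝ → ℝ → ℝ} {t₀ L c : ℝ}
    (hderiv : ∀ᶠ q : ℝ × ℝ in 𝓝[{q | 0 < q.1}] (0, t₀), HasDerivAt (f q.1) (f' q.1 q.2) q.2)
    (hL : Tendsto (fun q : ℝ × ℝ => f' q.1 q.2) (𝓝[{q | 0 < q.1}] (0, t₀)) (𝓝 L))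
    (hf : ∀ᶠ t in 𝓝 t₀, Tendsto (fun s => f s t) (𝓝[>] 0) (𝓝 c)) : L = 0 := by
  by_contra hne
  have hpos : 0 < |L| / 2 := by positivity
  have h1 := hderiv.and (hL.eventually (Metric.ball_mem_nhds L hpos))
  obtain ⟨η₁, hη₁, h1⟩ := Metric.eventually_nhds_iff.1 (eventually_nhdsWithin_iff.1 h1)
  obtain ⟨η₂, hη₂, h2⟩ := Metric.eventually_nhds_iff.1 hf
  obtain ⟨η, hη, hlt⟩ := exists_between (lt_min hη₁ hη₂)
  have hη1 : η < η₁ := hlt.trans_le (min_le_left _ _)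
  have hη2 : η < η₂ := hlt.trans_le (min_le_right _ _)
  have key : ∀ᶠ s in 𝓝[>] (0 : ℝ), |(f s (t₀ + η) - f s t₀) / η - L| ≤ |L| / 2 := by
    have : Ioo (0 : ℝ) η ∈ 𝓝[>] (0 : ℝ) := Ioo_mem_nhdsGT hη
    filter_upwards [this] with s hs
    have hb : ∀ t ∈ Icc t₀ (t₀ + η),
        HasDerivAt (f s) (f' s t) t ∧ f' s t ∈ Metric.ball L (|L| / 2) := by
      intro t ht
      refine @h1 (s, t) ?_ hs.1
      rw [Prod.dist_eq]
      refine max_lt ?_ ?_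
      · simp only [Real.dist_eq, sub_zero, abs_of_pos hs.1]; exact hs.2.trans hη1
      · simp only [Real.dist_eq]
        rw [abs_of_nonneg (by linarith [ht.1])]; linarith [ht.2]
    obtain ⟨ξ, hξ, hξ'⟩ := exists_hasDerivAt_eq_slope (f s) (f' s) (by linarith : t₀ < t₀ + η)
      (fun t ht => (hb t ht).1.continuousAt.continuousWithinAt)
      (fun t ht => (hb t (Ioo_subset_Icc_self ht)).1)
    have := (hb ξ (Ioo_subset_Icc_self hξ)).2
    rw [hξ', Metric.mem_ball, Real.dist_eq, add_sub_cancel_left] at this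
    exact this.le
  have hlim : Tendsto (fun s => |(f s (t₀ + η) - f s t₀) / η - L|) (𝓝[>] 0)
      (𝓝 |(c - c) / η - L|) := by
    have ha : Tendsto (fun s => f s (t₀ + η)) (𝓝[>] 0) (𝓝 c) := by
      apply h2; simp [abs_of_pos hη, hη2]
    have hb : Tendsto (fun s => f s t₀) (𝓝[>] 0) (𝓝 c) := by
      apply h2; simpa using hη₂
    exact (((ha.sub hb).div_const η).sub_const L).abs
  have := le_of_tendsto hlim key
  simp at this
  linarith [abs_pos.2 hne]

section Evaluation

variable {α V : Type*} [NormedAddCommGroup V] [NormedSpace ℝ V] {l : Filter α} {u v w : α → V}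
  {u₀ v₀ w₀ : V}

lemma tendsto_clm_apply {W : Type*} [NormedAddCommGroup W] [NormedSpace ℝ W] {A : α → V →L[ℝ] W}
    {A₀ : V →L[ℝ] W} (hA : Tendsto A l (𝓝 A₀)) (hu : Tendsto u l (𝓝 u₀)) :
    Tendsto (fun a => A a (u a)) l (𝓝 (A₀ u₀)) :=
  (isBoundedBilinearMap_apply.continuous.tendsto (A₀, u₀)).comp (hA.prodMk_nhds hu)

lemma tendsto_apply₂ {A : α → V →L[ℝ] V →L[ℝ] ℝ} {A₀ : V →L[ℝ] V →L[ℝ] ℝ}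
    (hA : Tendsto A l (𝓝 A₀)) (hu : Tendsto u l (𝓝 u₀)) (hv : Tendsto v l (𝓝 v₀)) :
    Tendsto (fun a => A a (u a) (v a)) l (𝓝 (A₀ u₀ v₀)) :=
  tendsto_clm_apply (tendsto_clm_apply hA hu) hv

lemma tendsto_apply₃ {A : α → V →L[ℝ] V →L[ℝ] V →L[ℝ] ℝ} {A₀ : V →L[ℝ] V →L[ℝ] V →L[ℝ] ℝ}
    (hA : Tendsto A l (𝓝 A₀)) (hu : Tendsto u l (𝓝 u₀)) (hv : Tendsto v l (𝓝 v₀))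
    (hw : Tendsto w l (𝓝 w₀)) : Tendsto (fun a => A a (u a) (v a) (w a)) l (𝓝 (A₀ u₀ v₀ w₀)) :=
  tendsto_apply₂ (tendsto_clm_apply hA hu) hv hw

lemma hasDerivAt_form_comp {B : V → V →L[ℝ] V →L[ℝ] ℝ} {X : V → V} {γ : ℝ → V} {γ' : V} {t : ℝ}
    (hB : DifferentiableAt ℝ B (γ t)) (hX : DifferentiableAt ℝ X (γ t)) (hγ : HasDerivAt γ γ' t)
    (v : V) : HasDerivAt (fun t => B (γ t) v (X (γ t)))
      (fderiv ℝ B (γ t) γ' v (X (γ t)) + B (γ t) v (fderiv ℝ X (γ t) γ')) t := by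
  have h1 : HasDerivAt (fun t => B (γ t)) _ t := hB.hasFDerivAt.comp_hasDerivAt t hγ
  have h2 : HasDerivAt (fun t => X (γ t)) _ t := hX.hasFDerivAt.comp_hasDerivAt t hγ
  simpa only [map_zero, add_zero] using (h1.clm_apply (hasDerivAt_const t v)).clm_apply h2

lemma hasDerivWithinAt_form_apply {B : V → V →L[ℝ] V →L[ℝ] ℝ} {B' : V →L[ℝ] V →L[ℝ] V →L[ℝ] ℝ}
    {γ : ℝ → V} {γ' : V} {t : ℝ} {S : Set V} {T : Set ℝ} (hB : HasFDerivWithinAt B B' S (γ t))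
    (hγ : HasDerivAt γ γ' t) (hT : MapsTo γ T S) (v w : V) :
    HasDerivWithinAt (fun t => B (γ t) v w) (B' γ' v w) T t := by
  have h1 : HasDerivWithinAt (fun t => B (γ t)) _ T t :=
    hB.comp_hasDerivWithinAt t hγ.hasDerivWithinAt hT
  simpa only [map_zero, add_zero] using (h1.clm_apply (hasDerivWithinAt_const t T v)).clm_apply
    (hasDerivWithinAt_const t T w)

lemma fderiv_form_apply {B : V → V →L[ℝ] V →L[ℝ] ℝ} {q : V} (hB : DifferentiableAt ℝ B q)
    (u v w : V) : fderiv ℝ (fun q => B q v w) q u = fderiv ℝ B q u v w := by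
  have h1 := (hB.hasFDerivAt.clm_apply (hasFDerivAt_const v q)).clm_apply (hasFDerivAt_const w q)
  rw [h1.fderiv]; simp

end Evaluation

section Collar

variable {H : Type*} [NormedAddCommGroup H] [NormedSpace ℝ H]

/-- The part over `O` of the collar `{(s, p) : 0 ≤ s < ε p}`, in a vector space. -/
def flatCollar (O : Set (ℝ × H)) (ε : ℝ × H → ℝ) : Set (ℝ × (ℝ × H)) :=
  {q | q.2 ∈ O ∧ 0 ≤ q.1 ∧ q.1 < ε q.2}

/-- The collar without its boundary face `s = 0`. -/
def openFlatCollar (O : Set (ℝ × H)) (ε : ℝ × H → ℝ) : Set (ℝ × (ℝ × H)) :=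
  {q | q.2 ∈ O ∧ 0 < q.1 ∧ q.1 < ε q.2}

/-- A symmetric form `B = ds² + B_s` of class `C^1` up to the boundary on a collar, nondegenerate
and with `B(∂_t, ∂_t) = -1` on the boundary, together with a field `X` on the open collar
that is Killing for `s⁻² B`, i.e. `L_X B = 2 (X^s / s) B`, and tends to `∂_t` at the boundary. -/
structure IsCollarKilling (O : Set (ℝ × H)) (ε : ℝ × H → ℝ)
    (B : ℝ × (ℝ × H) → ℝ × (ℝ × H) →L[ℝ] ℝ × (ℝ × H) →L[ℝ] ℝ)
    (X : ℝ × (ℝ × H) → ℝ × (ℝ × H)) : Prop where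
  isOpen : IsOpen O
  eps_cont : ContinuousOn ε O
  eps_pos : ∀ p ∈ O, 0 < ε p
  contDiffOn : ContDiffOn ℝ 1 B (flatCollar O ε)
  normal_form : ∀ q ∈ flatCollar O ε, ∀ v w, B q v w = v.1 * w.1 + B q (0, v.2) (0, w.2)
  symm : ∀ q ∈ flatCollar O ε, ∀ v w, B q v w = B q w v
  nondegenerate : ∀ q ∈ openFlatCollar O ε, ∀ v, (∀ w, B q v w = 0) → v = 0
  boundary : ∀ p ∈ O, B (0, p) (0, (1, 0)) (0, (1, 0)) = -1
  differentiableAt : ∀ q ∈ openFlatCollar O ε, DifferentiableAt ℝ X q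
  killing : ∀ q ∈ openFlatCollar O ε, ∀ v w,
    fderiv ℝ B q (X q) v w + B q (fderiv ℝ X q v) w + B q v (fderiv ℝ X q w)
      = 2 * ((X q).1 / q.1) * B q v w
  tendsto : ∀ p ∈ O, Tendsto X (𝓝[openFlatCollar O ε] (0, p)) (𝓝 (0, (1, 0)))

variable {O : Set (ℝ × H)} {ε : ℝ × H → ℝ}

lemma openFlatCollar_subset : openFlatCollar O ε ⊆ flatCollar O ε :=
  fun _ h => ⟨h.1, h.2.1.le, h.2.2⟩

lemma isOpen_below_graph (hO : IsOpen O) (hε : ContinuousOn ε O) :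
    IsOpen {q : ℝ × (ℝ × H) | q.2 ∈ O ∧ q.1 < ε q.2} := by
  have h1 : IsOpen ((univ : Set ℝ) ×ˢ O) := isOpen_univ.prod hO
  have h2 : ContinuousOn (fun q : ℝ × (ℝ × H) => ε q.2 - q.1) (univ ×ˢ O) :=
    (hε.comp continuousOn_snd (fun q hq => hq.2)).sub continuousOn_fst
  convert h2.isOpen_inter_preimage h1 (isOpen_Ioi (a := (0 : ℝ))) using 1
  ext q; simp

lemma isOpen_openFlatCollar (hO : IsOpen O) (hε : ContinuousOn ε O) :
    IsOpen (openFlatCollar O ε) := by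
  convert (isOpen_below_graph hO hε).inter
    (isOpen_lt continuous_const continuous_fst : IsOpen {q : ℝ × (ℝ × H) | 0 < q.1}) using 1
  ext q; simp only [openFlatCollar, mem_ofPred_eq, mem_inter_iff]; tauto

lemma uniqueDiffOn_flatCollar (hO : IsOpen O) (hε : ContinuousOn ε O) :
    UniqueDiffOn ℝ (flatCollar O ε) := by
  have h : UniqueDiffOn ℝ ((Ici (0 : ℝ)) ×ˢ (univ : Set (ℝ × H))) :=
    (uniqueDiffOn_Ici 0).prod uniqueDiffOn_univ
  convert h.inter (isOpen_below_graph hO hε) using 1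
  ext q; simp only [flatCollar, mem_ofPred_eq, mem_inter_iff, mem_prod, mem_Ici, mem_univ]; tauto

namespace IsCollarKilling

variable {B : ℝ × (ℝ × H) → ℝ × (ℝ × H) →L[ℝ] ℝ × (ℝ × H) →L[ℝ] ℝ}
  {X : ℝ × (ℝ × H) → ℝ × (ℝ × H)}

lemma isOpen_interior (h : IsCollarKilling O ε B X) : IsOpen (openFlatCollar O ε) :=
  isOpen_openFlatCollar h.isOpen h.eps_cont

lemma mem_nhds (h : IsCollarKilling O ε B X) {q : ℝ × (ℝ × H)}
    (hq : q ∈ openFlatCollar O ε) : flatCollar O ε ∈ 𝓝 q :=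
  mem_of_superset (h.isOpen_interior.mem_nhds hq) openFlatCollar_subset

lemma differentiableAt_form (h : IsCollarKilling O ε B X) {q : ℝ × (ℝ × H)}
    (hq : q ∈ openFlatCollar O ε) :
    DifferentiableAt ℝ B q :=
  ((h.contDiffOn.differentiableOn one_ne_zero) q (openFlatCollar_subset hq)).differentiableAt
    (h.mem_nhds hq)

lemma inner_ds (h : IsCollarKilling O ε B X) {q : ℝ × (ℝ × H)}
    (hq : q ∈ flatCollar O ε) (v : ℝ × (ℝ × H)) :
    B q (1, 0) v = v.1 := by
  rw [h.normal_form q hq]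
  have : ((0 : ℝ), (0 : ℝ × H)) = 0 := rfl
  simp [this]

lemma fderiv_inner_ds (h : IsCollarKilling O ε B X) {q : ℝ × (ℝ × H)}
    (hq : q ∈ openFlatCollar O ε) (u v : ℝ × (ℝ × H)) :
    fderiv ℝ B q u (1, 0) v = 0 := by
  rw [← fderiv_form_apply (h.differentiableAt_form hq)]
  have : (fun q => B q (1, 0) v) =ᶠ[𝓝 q] fun _ => v.1 := by
    filter_upwards [h.isOpen_interior.mem_nhds hq] with q' hq'
    exact h.inner_ds (openFlatCollar_subset hq') v
  rw [this.fderiv_eq]; simp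

/-- The `(s, s)` component of the Killing equation: `∂_s X^s = X^s / s`. -/
lemma fderiv_ds_fst (h : IsCollarKilling O ε B X) {q : ℝ × (ℝ × H)}
    (hq : q ∈ openFlatCollar O ε) :
    (fderiv ℝ X q (1, 0)).1 = (X q).1 / q.1 := by
  have h1 := h.killing q hq (1, 0) (1, 0)
  have hq' := openFlatCollar_subset hq
  rw [h.fderiv_inner_ds hq, h.symm q hq' (fderiv ℝ X q (1, 0)), h.inner_ds hq',
    h.inner_ds hq'] at h1
  simp at h1
  linarith

lemma sline_hasDerivAt (p : ℝ × H) (s : ℝ) :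
    HasDerivAt (fun s : ℝ => ((s, p) : ℝ × (ℝ × H))) (1, 0) s :=
  (hasDerivAt_id s).prodMk (hasDerivAt_const s p)

/-- Along the lines of constant `(t, θ)`, `X^s` is a constant multiple of `s`. -/
lemma fst_div_eq (h : IsCollarKilling O ε B X) {p : ℝ × H} {s s' : ℝ}
    (hs : (s, p) ∈ openFlatCollar O ε)
    (hs' : (s', p) ∈ openFlatCollar O ε) : (X (s, p)).1 / s = (X (s', p)).1 / s' := by
  have hd : ∀ u ∈ Ioo 0 (ε p), HasDerivAt (fun u => (X (u, p)).1 / u) 0 u := by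
    intro u hu
    have hq : (u, p) ∈ openFlatCollar O ε := ⟨hs.1, hu⟩
    have h1 : HasDerivAt (fun u => X (u, p)) (fderiv ℝ X (u, p) (1, 0)) u :=
      (h.differentiableAt _ hq).hasFDerivAt.comp_hasDerivAt u (sline_hasDerivAt p u)
    have h2 := (show HasDerivAt (fun u => (X (u, p)).1) _ u from
      hasFDerivAt_fst.comp_hasDerivAt u h1).div (hasDerivAt_id u) hu.1.ne'
    have h3 : (ContinuousLinearMap.fst ℝ ℝ (ℝ × H)) (fderiv ℝ X (u, p) (1, 0))
        = (X (u, p)).1 / u :=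
      h.fderiv_ds_fst hq
    have := hu.1.ne'
    rw [h3] at h2
    simp only [id, mul_one, div_mul_cancel₀ _ this, sub_self, zero_div] at h2
    exact h2
  exact isOpen_Ioo.is_const_of_deriv_eq_zero isPreconnected_Ioo
    (fun u hu => (hd u hu).differentiableAt.differentiableWithinAt)
    (fun u hu => (hd u hu).deriv) hs.2 hs'.2

lemma tline_hasDerivAt (s : ℝ) (z : H) (t : ℝ) :
    HasDerivAt (fun t : ℝ => ((s, (t, z)) : ℝ × (ℝ × H))) (0, (1, 0)) t :=
  (hasDerivAt_const t s).prodMk ((hasDerivAt_id t).prodMk (hasDerivAt_const t z))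

/-- At the boundary, `B(∂_t, ∂_t) = -1` does not change along `∂_t`; this is a statement about
the one-sided derivative of `B`, as `∂_t` is tangent to the boundary face. -/
lemma fderivWithin_boundary (h : IsCollarKilling O ε B X) {t : ℝ} {z : H} (hp : (t, z) ∈ O) :
    fderivWithin ℝ B (flatCollar O ε) (0, (t, z)) (0, (1, 0)) (0, (1, 0)) (0, (1, 0)) = 0 := by
  have hmem : ∀ {p : ℝ × H}, p ∈ O → ((0 : ℝ), p) ∈ flatCollar O ε := fun {p} hp =>
    ⟨hp, le_rfl, h.eps_pos p hp⟩
  have hO : (fun τ : ℝ => (τ, z)) ⁻¹' O ∈ 𝓝 t :=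
    (h.isOpen.preimage (by fun_prop)).mem_nhds hp
  have h1 : HasFDerivWithinAt B (fderivWithin ℝ B (flatCollar O ε) (0, (t, z)))
      (flatCollar O ε) (0, (t, z)) :=
    ((h.contDiffOn.differentiableOn one_ne_zero) _ (hmem hp)).hasFDerivWithinAt
  have h4 := (hasDerivWithinAt_form_apply (T := (fun τ : ℝ => (τ, z)) ⁻¹' O) h1
    (tline_hasDerivAt 0 z t) (fun τ hτ => hmem hτ) (0, (1, 0)) (0, (1, 0))).hasDerivAt hO
  have h5 : (fun τ : ℝ => B (0, (τ, z)) (0, (1, 0)) (0, (1, 0))) =ᶠ[𝓝 t] fun _ => -1 := by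
    filter_upwards [hO] with τ hτ using h.boundary _ hτ
  exact h4.unique ((hasDerivAt_const t (-1 : ℝ)).congr_of_eventuallyEq h5)

/-- The `(t, t)` component of the Killing equation, written for the derivative of `B(∂_t, X)`. -/
lemma hasDerivAt_inner_dt (h : IsCollarKilling O ε B X) {q : ℝ × (ℝ × H)}
    (hq : q ∈ openFlatCollar O ε) :
    HasDerivAt (fun t => B (q.1, (t, q.2.2)) (0, (1, 0)) (X (q.1, (t, q.2.2))))
      (fderiv ℝ B q (0, (1, 0)) (0, (1, 0)) (X q)
        - (1 / 2) * fderiv ℝ B q (X q) (0, (1, 0)) (0, (1, 0))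
        + (X q).1 / q.1 * B q (0, (1, 0)) (0, (1, 0))) q.2.1 := by
  obtain ⟨s, t, z⟩ := q
  have h1 := hasDerivAt_form_comp (h.differentiableAt_form hq) (h.differentiableAt _ hq)
    (tline_hasDerivAt s z t) (0, (1, 0))
  have h2 := h.killing _ hq (0, (1, 0)) (0, (1, 0))
  rw [h.symm _ (openFlatCollar_subset hq) (fderiv ℝ X _ (0, (1, 0)))] at h2
  refine h1.congr_deriv ?_
  linarith

/-- The `s`-component of `X` vanishes: `X^s = c s`, and the mean value theorem along `∂_t`, applied to
the `(t, t)` component of the Killing equation, gives `c = 0` as `s → 0`. -/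
lemma fst_eq_zero (h : IsCollarKilling O ε B X) {q : ℝ × (ℝ × H)}
    (hq : q ∈ openFlatCollar O ε) : (X q).1 = 0 := by
  obtain ⟨s₁, t₀, z⟩ := q
  have hs₁ : 0 < s₁ := hq.2.1
  have hO : (t₀, z) ∈ O := hq.1
  have h0 : ((0 : ℝ), (t₀, z)) ∈ flatCollar O ε := ⟨hO, le_rfl, h.eps_pos _ hO⟩
  -- the slice through `(t₀, z)` spanned by `∂_s` and `∂_t`
  let j : ℝ × ℝ → ℝ × (ℝ × H) := fun q => (q.1, (q.2, z))
  have hj : Continuous j := by fun_prop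
  have hjmem : ∀ t, (t, z) ∈ O → ∀ᶠ q in 𝓝[{q : ℝ × ℝ | 0 < q.1}] (0, t),
      j q ∈ openFlatCollar O ε := by
    intro t ht
    have h1 := (hj.continuousAt (x := (0, t))).eventually
      ((isOpen_below_graph h.isOpen h.eps_cont).mem_nhds
        (show j (0, t) ∈ _ from ⟨ht, h.eps_pos _ ht⟩))
    filter_upwards [nhdsWithin_le_nhds h1, self_mem_nhdsWithin] with q hq hq'
    exact ⟨hq.1, hq', hq.2⟩
  have hjt : ∀ t, (t, z) ∈ O → Tendsto j (𝓝[{q : ℝ × ℝ | 0 < q.1}] (0, t))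
      (𝓝[openFlatCollar O ε] (0, (t, z))) := fun t ht =>
    tendsto_nhdsWithin_iff.2 ⟨(hj.tendsto (0, t)).mono_left nhdsWithin_le_nhds, hjmem t ht⟩
  have hsub : ∀ p, 𝓝[openFlatCollar O ε] p ≤ 𝓝[flatCollar O ε] p := fun p =>
    nhdsWithin_mono p openFlatCollar_subset
  have hBt : ∀ t, (t, z) ∈ O → Tendsto (fun q => B (j q)) (𝓝[{q : ℝ × ℝ | 0 < q.1}] (0, t))
      (𝓝 (B (0, (t, z)))) := fun t ht =>
    (h.contDiffOn.continuousOn _ ⟨ht, le_rfl, h.eps_pos _ ht⟩).tendsto.comp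
      ((hjt t ht).mono_right (hsub _))
  have hXt : ∀ t, (t, z) ∈ O → Tendsto (fun q => X (j q)) (𝓝[{q : ℝ × ℝ | 0 < q.1}] (0, t))
      (𝓝 (0, (1, 0))) := fun t ht => (h.tendsto _ ht).comp (hjt t ht)
  have hDB : Tendsto (fun q => fderiv ℝ B (j q)) (𝓝[{q : ℝ × ℝ | 0 < q.1}] (0, t₀))
      (𝓝 (fderivWithin ℝ B (flatCollar O ε) (0, (t₀, z)))) := by
    have h1 := ((h.contDiffOn.continuousOn_fderivWithin
      (uniqueDiffOn_flatCollar h.isOpen h.eps_cont) le_rfl) _ h0).tendsto.comp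
        ((hjt t₀ hO).mono_right (hsub _))
    refine h1.congr' ?_
    filter_upwards [hjmem t₀ hO] with q hq
    exact fderivWithin_of_mem_nhds (h.mem_nhds hq)
  -- `X^s / s` does not depend on `s`, hence is continuous up to the boundary
  have hc : Tendsto (fun q => (X (j q)).1 / q.1) (𝓝[{q : ℝ × ℝ | 0 < q.1}] (0, t₀))
      (𝓝 ((X (s₁, (t₀, z))).1 / s₁)) := by
    have h1 : ContinuousAt (fun t : ℝ => (X (s₁, (t, z))).1 / s₁) t₀ :=
      ((h.differentiableAt _ hq).continuousAt.comp_of_eq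
        (f := fun t : ℝ => (s₁, (t, z))) (by fun_prop) rfl).fst.div_const _
    have h2 : Tendsto (fun q : ℝ × ℝ => q.2) (𝓝[{q : ℝ × ℝ | 0 < q.1}] (0, t₀)) (𝓝 t₀) :=
      (continuous_snd.tendsto (0, t₀)).mono_left nhdsWithin_le_nhds
    have h3 : ∀ᶠ t in 𝓝 t₀, (s₁, (t, z)) ∈ openFlatCollar O ε :=
      (show ContinuousAt (fun t : ℝ => ((s₁, (t, z)) : ℝ × (ℝ × H))) t₀ by fun_prop).eventually
        (h.isOpen_interior.mem_nhds hq)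
    refine (h1.tendsto.comp h2).congr' ?_
    filter_upwards [hjmem t₀ hO, h2.eventually h3] with q hq hq'
    exact h.fst_div_eq hq' hq
  have hdt : Tendsto (fun _ : ℝ × ℝ => ((0, (1, 0)) : ℝ × (ℝ × H)))
      (𝓝[{q : ℝ × ℝ | 0 < q.1}] (0, t₀)) (𝓝 (0, (1, 0))) := tendsto_const_nhds
  have hlim := ((tendsto_apply₃ hDB hdt hdt (hXt t₀ hO)).sub
    ((tendsto_apply₃ hDB (hXt t₀ hO) hdt hdt).const_mul (1 / 2))).add
    (hc.mul (tendsto_apply₂ (hBt t₀ hO) hdt hdt))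
  rw [h.fderivWithin_boundary hO, h.boundary _ hO] at hlim
  have hfin := eq_zero_of_tendsto_deriv (c := -1)
    (f := fun s t => B (s, (t, z)) (0, (1, 0)) (X (s, (t, z))))
    (f' := fun s t => fderiv ℝ B (s, (t, z)) (0, (1, 0)) (0, (1, 0)) (X (s, (t, z)))
        - (1 / 2) * fderiv ℝ B (s, (t, z)) (X (s, (t, z))) (0, (1, 0)) (0, (1, 0))
        + (X (s, (t, z))).1 / s * B (s, (t, z)) (0, (1, 0)) (0, (1, 0)))
    (by filter_upwards [hjmem t₀ hO] with q hq using h.hasDerivAt_inner_dt hq) hlim ?_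
  · have : (X (s₁, (t₀, z))).1 / s₁ = 0 := by linarith
    rcases div_eq_zero_iff.1 this with h' | h'
    · exact h'
    · exact absurd h' hs₁.ne'
  · have hO' : (fun τ : ℝ => (τ, z)) ⁻¹' O ∈ 𝓝 t₀ :=
      (h.isOpen.preimage (by fun_prop)).mem_nhds hO
    filter_upwards [hO'] with t ht
    have h1 : Tendsto (fun s : ℝ => (s, t)) (𝓝[>] 0) (𝓝[{q : ℝ × ℝ | 0 < q.1}] (0, t)) :=
      tendsto_nhdsWithin_iff.2 ⟨((by fun_prop : Continuous fun s : ℝ => (s, t)).tendsto 0).mono_left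
        nhdsWithin_le_nhds, by filter_upwards [self_mem_nhdsWithin] with s hs using hs⟩
    have h2 := (tendsto_apply₂ (hBt t ht) (tendsto_const_nhds (x := ((0, (1, 0)) : ℝ × (ℝ × H))))
      (hXt t ht)).comp h1
    rwa [h.boundary _ ht] at h2

/-- The `(s, A)` components of the Killing equation: `∂_s X = 0` once `X^s = 0`. -/
lemma fderiv_ds_eq_zero (h : IsCollarKilling O ε B X) {q : ℝ × (ℝ × H)}
    (hq : q ∈ openFlatCollar O ε) : fderiv ℝ X q (1, 0) = 0 := by
  have hq' := openFlatCollar_subset hq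
  refine h.nondegenerate q hq _ fun w => ?_
  have h0 : (fderiv ℝ X q w).1 = 0 := by
    have h1 : HasFDerivAt (fun q => (X q).1)
        ((ContinuousLinearMap.fst ℝ ℝ (ℝ × H)).comp (fderiv ℝ X q)) q :=
      hasFDerivAt_fst.comp q (h.differentiableAt q hq).hasFDerivAt
    have h2 : (fun q => (X q).1) =ᶠ[𝓝 q] fun _ => 0 := by
      filter_upwards [h.isOpen_interior.mem_nhds hq] with q' hq' using h.fst_eq_zero hq'
    have h3 := h1.unique ((hasFDerivAt_const (0 : ℝ) q).congr_of_eventuallyEq h2)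
    exact congrArg (fun l => l w) h3
  have h1 := h.killing q hq (1, 0) w
  rw [h.fderiv_inner_ds hq, h.fst_eq_zero hq, h.inner_ds hq', h0] at h1
  simpa using h1

/-- A Killing field of `s⁻² B` that tends to `∂_t` at the boundary is `∂_t`. -/
theorem eq_dt (h : IsCollarKilling O ε B X) {q : ℝ × (ℝ × H)} (hq : q ∈ openFlatCollar O ε) :
    X q = (0, (1, 0)) := by
  obtain ⟨s, p⟩ := q
  have hd : ∀ u ∈ Ioo 0 (ε p), HasDerivAt (fun u => X (u, p)) 0 u := by
    intro u hu
    have hu' : (u, p) ∈ openFlatCollar O ε := ⟨hq.1, hu⟩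
    rw [← h.fderiv_ds_eq_zero hu']
    exact (h.differentiableAt _ hu').hasFDerivAt.comp_hasDerivAt u (sline_hasDerivAt p u)
  have hconst : ∀ u ∈ Ioo 0 (ε p), X (u, p) = X (s, p) := fun u hu =>
    isOpen_Ioo.is_const_of_deriv_eq_zero isPreconnected_Ioo
      (fun u hu => (hd u hu).differentiableAt.differentiableWithinAt)
      (fun u hu => (hd u hu).deriv) hu hq.2
  have hev : ∀ᶠ u in 𝓝[>] (0 : ℝ), u ∈ Ioo 0 (ε p) := Ioo_mem_nhdsGT (h.eps_pos p hq.1)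
  have h1 : Tendsto (fun u : ℝ => (u, p)) (𝓝[>] 0) (𝓝[openFlatCollar O ε] (0, p)) :=
    tendsto_nhdsWithin_iff.2 ⟨((by fun_prop : Continuous fun u : ℝ => (u, p)).tendsto 0).mono_left
      nhdsWithin_le_nhds, by filter_upwards [hev] with u hu using ⟨hq.1, hu⟩⟩
  have h2 : Tendsto (fun u : ℝ => X (u, p)) (𝓝[>] 0) (𝓝 (X (s, p))) :=
    tendsto_const_nhds.congr' (by filter_upwards [hev] with u hu using (hconst u hu).symm)
  exact tendsto_nhds_unique h2 ((h.tendsto p hq.1).comp h1)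

/-- For `X = ∂_t` the Killing equation says that the components of `B` do not change along `∂_t`. -/
theorem form_eq (h : IsCollarKilling O ε B X) {s t t' : ℝ} {z : H}
    (hseg : ∀ τ ∈ uIcc t t', (s, (τ, z)) ∈ openFlatCollar O ε) (v w : ℝ × (ℝ × H)) :
    B (s, (t, z)) v w = B (s, (t', z)) v w := by
  have hd : ∀ τ ∈ uIcc t t', HasDerivAt (fun τ => B (s, (τ, z)) v w) 0 τ := by
    intro τ hτ
    have hq := hseg τ hτ
    have h1 := (hasDerivWithinAt_form_apply (T := univ)
      (h.differentiableAt_form hq).hasFDerivAt.hasFDerivWithinAt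
      (tline_hasDerivAt s z τ) (mapsTo_univ _ _) v w).hasDerivAt univ_mem
    have hX0 : fderiv ℝ X (s, (τ, z)) = 0 := by
      have : X =ᶠ[𝓝 (s, (τ, z))] fun _ => (0, (1, 0)) := by
        filter_upwards [h.isOpen_interior.mem_nhds hq] with q' hq' using h.eq_dt hq'
      rw [this.fderiv_eq, fderiv_fun_const]; rfl
    have h2 := h.killing _ hq v w
    rw [hX0, h.eq_dt hq] at h2
    simp only [zero_apply, map_zero, add_zero, zero_div, mul_zero,
      zero_mul] at h2
    rwa [h2] at h1
  -- a function with derivative zero on the segment takes equal values at its ends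
  have hint : ∫ τ in t..t', (0 : ℝ) = B (s, (t', z)) v w - B (s, (t, z)) v w :=
    intervalIntegral.integral_eq_sub_of_hasDerivAt hd intervalIntegrable_const
  rw [intervalIntegral.integral_zero] at hint
  linarith

end IsCollarKilling
end Collar

/-! ### The Killing equation in coordinates -/

section Killing

variable {m : ℕ} {Y : Type*} [TopologicalSpace Y] [ChartedSpace (EuclideanHalfSpace (m + 2)) Y]
  [IsManifold (AdS.I m) ∞ Y] {V : Type*} [NormedAddCommGroup V] [NormedSpace ℝ V]

/-- `F` and `G` are inverse `C^2` maps between the open subset `D` of a vector space and the open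
subset `T` of `Y`: a parametrization of `T` and the corresponding coordinates. -/
structure IsParametrization (D : Set V) (T : Set Y) (F : V → Y) (G : Y → V) : Prop where
  isOpen_source : IsOpen D
  isOpen_target : IsOpen T
  contMDiffOn : ContMDiffOn 𝓘(ℝ, V) (AdS.I m) 2 F D
  contMDiffOn_symm : ContMDiffOn (AdS.I m) 𝓘(ℝ, V) 2 G T
  mapsTo : MapsTo F D T
  mapsTo_symm : MapsTo G T D
  left_inv : ∀ q ∈ D, G (F q) = q
  right_inv : ∀ y ∈ T, F (G y) = y

/-- The components of the field `X` in the coordinates `G`, at the point `F q`. They are given by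
`dG` rather than by the inverse of `dF`, so that they make sense up to the boundary of `Y`. -/
noncomputable def coordField (F : V → Y) (G : Y → V) (X : ∀ y : Y, TangentSpace (AdS.I m) y)
    (q : V) : V :=
  mfderiv (AdS.I m) 𝓘(ℝ, V) G (F q) (X (F q))

lemma mlieBracket_vectorSpace (W Z : V → V) (q : V) :
    (VectorField.mlieBracket 𝓘(ℝ, V) W Z q : V) = fderiv ℝ Z q (W q) - fderiv ℝ W q (Z q) := by
  have h1 : VectorField.mlieBracket 𝓘(ℝ, V) W Z q = VectorField.lieBracketWithin ℝ W Z univ q :=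
    congrFun (VectorField.mlieBracketWithin_univ.symm.trans
      VectorField.mlieBracketWithin_eq_lieBracketWithin) q
  rw [VectorField.lieBracketWithin_univ] at h1
  exact h1

namespace IsParametrization

variable {D : Set V} {T : Set Y} {F : V → Y} {G : Y → V} {q : V}

lemma contMDiffAt (h : IsParametrization (m := m) D T F G) (hq : q ∈ D) :
    ContMDiffAt 𝓘(ℝ, V) (AdS.I m) 2 F q :=
  h.contMDiffOn.contMDiffAt (h.isOpen_source.mem_nhds hq)

lemma contMDiffAt_symm (h : IsParametrization (m := m) D T F G) {y : Y} (hy : y ∈ T) :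
    ContMDiffAt (AdS.I m) 𝓘(ℝ, V) 2 G y :=
  h.contMDiffOn_symm.contMDiffAt (h.isOpen_target.mem_nhds hy)

lemma mfderiv_symm_comp (h : IsParametrization (m := m) D T F G) (hq : q ∈ D) :
    (mfderiv (AdS.I m) 𝓘(ℝ, V) G (F q)).comp (mfderiv 𝓘(ℝ, V) (AdS.I m) F q)
      = ContinuousLinearMap.id ℝ V := by
  rw [← mfderiv_comp q ((h.contMDiffAt_symm (h.mapsTo hq)).mdifferentiableAt two_ne_zero)
    ((h.contMDiffAt hq).mdifferentiableAt two_ne_zero)]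
  have : G ∘ F =ᶠ[𝓝 q] id := by
    filter_upwards [h.isOpen_source.mem_nhds hq] with q' hq' using h.left_inv q' hq'
  rw [this.mfderiv_eq]
  exact mfderiv_id

lemma mfderiv_comp_symm (h : IsParametrization (m := m) D T F G) (hq : q ∈ D) :
    (mfderiv 𝓘(ℝ, V) (AdS.I m) F q).comp (mfderiv (AdS.I m) 𝓘(ℝ, V) G (F q))
      = ContinuousLinearMap.id ℝ (TangentSpace (AdS.I m) (F q)) := by
  have hy := h.mapsTo hq
  have hF : MDifferentiableAt 𝓘(ℝ, V) (AdS.I m) F (G (F q)) := by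
    rw [h.left_inv q hq]; exact (h.contMDiffAt hq).mdifferentiableAt two_ne_zero
  have h1 := mfderiv_comp (F q) hF ((h.contMDiffAt_symm hy).mdifferentiableAt two_ne_zero)
  have h2 : F ∘ G =ᶠ[𝓝 (F q)] id := by
    filter_upwards [h.isOpen_target.mem_nhds hy] with y hy using h.right_inv y hy
  have h3 : ∀ p, p = q → ∀ u : V, (mfderiv 𝓘(ℝ, V) (AdS.I m) F p u : E m)
      = mfderiv 𝓘(ℝ, V) (AdS.I m) F q u := by
    rintro _ rfl _; rfl
  refine ContinuousLinearMap.ext fun u => ?_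
  have h4 : mfderiv (AdS.I m) (AdS.I m) (F ∘ G) (F q) = mfderiv (AdS.I m) (AdS.I m) id (F q) :=
    h2.mfderiv_eq
  exact (h3 _ (h.left_inv q hq) _).symm.trans
    (congrArg (fun l : E m →L[ℝ] E m => l u) (h1.symm.trans (h4.trans mfderiv_id)))

lemma inverse_mfderiv (h : IsParametrization (m := m) D T F G) (hq : q ∈ D) :
    (mfderiv 𝓘(ℝ, V) (AdS.I m) F q).inverse = mfderiv (AdS.I m) 𝓘(ℝ, V) G (F q) :=
  ContinuousLinearMap.inverse_eq (h.mfderiv_comp_symm hq) (h.mfderiv_symm_comp hq)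

lemma inverse_mfderiv_symm (h : IsParametrization (m := m) D T F G) (hq : q ∈ D) :
    (mfderiv (AdS.I m) 𝓘(ℝ, V) G (F q)).inverse = mfderiv 𝓘(ℝ, V) (AdS.I m) F q :=
  ContinuousLinearMap.inverse_eq (h.mfderiv_symm_comp hq) (h.mfderiv_comp_symm hq)

lemma isInvertible_mfderiv (h : IsParametrization (m := m) D T F G) (hq : q ∈ D) :
    (mfderiv 𝓘(ℝ, V) (AdS.I m) F q).IsInvertible :=
  .of_inverse (h.mfderiv_comp_symm hq) (h.mfderiv_symm_comp hq)

lemma isInvertible_mfderiv_symm (h : IsParametrization (m := m) D T F G) (hq : q ∈ D) :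
    (mfderiv (AdS.I m) 𝓘(ℝ, V) G (F q)).IsInvertible :=
  .of_inverse (h.mfderiv_symm_comp hq) (h.mfderiv_comp_symm hq)

variable {X : ∀ y : Y, TangentSpace (AdS.I m) y}

lemma mfderiv_coordField (h : IsParametrization (m := m) D T F G) (hq : q ∈ D) :
    mfderiv 𝓘(ℝ, V) (AdS.I m) F q (coordField (V := V) F G X q) = X (F q) :=
  congrArg (fun l : E m →L[ℝ] E m => l (X (F q))) (h.mfderiv_comp_symm hq)

lemma mpullback_eventuallyEq (h : IsParametrization (m := m) D T F G) (hq : q ∈ D) :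
    VectorField.mpullback 𝓘(ℝ, V) (AdS.I m) F X =ᶠ[𝓝 q] coordField F G X := by
  filter_upwards [h.isOpen_source.mem_nhds hq] with q' hq'
  rw [VectorField.mpullback_apply, h.inverse_mfderiv hq']
  rfl

/-- The field on `Y` with constant components `v` in the coordinates `G`. -/
noncomputable def constField (G : Y → V) (v : V) : ∀ y : Y, TangentSpace (AdS.I m) y :=
  VectorField.mpullback (AdS.I m) 𝓘(ℝ, V) G (fun _ => v)

lemma constField_apply (h : IsParametrization (m := m) D T F G) (hq : q ∈ D) (v : V) :
    constField (m := m) G v (F q) = mfderiv 𝓘(ℝ, V) (AdS.I m) F q v :=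
  congrArg (fun l : V →L[ℝ] E m => l v) (h.inverse_mfderiv_symm hq)

variable [CompleteSpace V]

lemma mdifferentiableAt_constField (h : IsParametrization (m := m) D T F G) (hq : q ∈ D) (v : V) :
    MDifferentiableAt (AdS.I m) (AdS.I m).tangent
      (fun y => (⟨y, constField (m := m) G v y⟩ : TangentBundle (AdS.I m) Y)) (F q) := by
  refine MDifferentiableAt.mpullback_vectorField (n := 2) ?_ (h.contMDiffAt_symm (h.mapsTo hq))
    (h.isInvertible_mfderiv_symm hq) le_rfl
  exact (contMDiff_vectorSpace_iff_contDiff (n := 1)).2 contDiff_const |>.mdifferentiable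
    one_ne_zero _

lemma differentiableAt_coordField (h : IsParametrization (m := m) D T F G) (hq : q ∈ D)
    (hX : MDifferentiableAt (AdS.I m) (AdS.I m).tangent
      (fun y => (⟨y, X y⟩ : TangentBundle (AdS.I m) Y)) (F q)) :
    DifferentiableAt ℝ (coordField F G X) q := by
  have h1 : MDifferentiableAt 𝓘(ℝ, V) 𝓘(ℝ, V).tangent (fun q' =>
      (⟨q', VectorField.mpullback 𝓘(ℝ, V) (AdS.I m) F X q'⟩ : TangentBundle 𝓘(ℝ, V) V)) q :=
    MDifferentiableAt.mpullback_vectorField (n := 2) hX (h.contMDiffAt hq)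
      (h.isInvertible_mfderiv hq) le_rfl
  have h2 : DifferentiableAt ℝ (VectorField.mpullback 𝓘(ℝ, V) (AdS.I m) F X : V → V) q := by
    have h3 := ((contMDiff_snd_tangentBundle_modelSpace V 𝓘(ℝ, V)).mdifferentiable
      one_ne_zero _).comp q h1
    exact h3.differentiableAt
  exact h2.congr_of_eventuallyEq (h.mpullback_eventuallyEq hq).symm

/-- The bracket with a field with constant components `v` is `-∂_v X`, in components. -/
lemma mlieBracket_constField (h : IsParametrization (m := m) D T F G) (hq : q ∈ D)
    (hX : MDifferentiableAt (AdS.I m) (AdS.I m).tangent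
      (fun y => (⟨y, X y⟩ : TangentBundle (AdS.I m) Y)) (F q)) (v : V) :
    VectorField.mlieBracket (AdS.I m) X (constField G v) (F q)
      = -mfderiv 𝓘(ℝ, V) (AdS.I m) F q (fderiv ℝ (coordField F G X) q v) := by
  have : IsManifold (AdS.I m) (minSmoothness ℝ 2) Y := by
    rw [minSmoothness_of_isRCLikeNormedField]; infer_instance
  have h1 := VectorField.mpullback_mlieBracket (n := 2) hX (h.mdifferentiableAt_constField hq v)
    (h.contMDiffAt hq) (by simp)
  have hc : VectorField.mpullback 𝓘(ℝ, V) (AdS.I m) F (constField G v) =ᶠ[𝓝 q] fun _ => v := by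
    filter_upwards [h.isOpen_source.mem_nhds hq] with q' hq'
    have h2 := congrArg (fun l : V →L[ℝ] V => l v) (h.mfderiv_symm_comp hq')
    have h3 := congrArg (fun u : E m => (mfderiv (AdS.I m) 𝓘(ℝ, V) G (F q') : E m →L[ℝ] V) u)
      (h.constField_apply hq' v)
    rw [VectorField.mpullback_apply, h.inverse_mfderiv hq']
    exact h3.trans h2
  rw [(h.mpullback_eventuallyEq hq).mlieBracket_vectorField_eq hc] at h1
  have h2 : VectorField.mlieBracket 𝓘(ℝ, V) (coordField F G X) (fun _ => v) q
      = -(fderiv ℝ (coordField F G X) q v) := by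
    refine (mlieBracket_vectorSpace _ _ q).trans ?_
    simp only [fderiv_fun_const, Pi.zero_apply, zero_apply, zero_sub]
    rfl
  rw [h2, VectorField.mpullback_apply, h.inverse_mfderiv hq] at h1
  have h3 := congrArg (fun l : E m →L[ℝ] E m =>
    l (VectorField.mlieBracket (AdS.I m) X (constField G v) (F q))) (h.mfderiv_comp_symm hq)
  have h4 := congrArg (fun u : V => (mfderiv 𝓘(ℝ, V) (AdS.I m) F q : V →L[ℝ] E m) u) h1
  exact h3.symm.trans (h4.trans (map_neg (mfderiv 𝓘(ℝ, V) (AdS.I m) F q : V →L[ℝ] E m) _))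

/-- The Killing equation in coordinates: `X (g(v, w)) + g(∂_v X, w) + g(v, ∂_w X) = 0` for constant
vectors `v`, `w`. -/
theorem killing_eq (h : IsParametrization (m := m) D T F G) (hq : q ∈ D) {g : BilinField m Y}
    (hK : IsKillingField g X) (hint : F q ∈ (AdS.I m).interior Y)
    (hX : MDifferentiableAt (AdS.I m) (AdS.I m).tangent
      (fun y => (⟨y, X y⟩ : TangentBundle (AdS.I m) Y)) (F q)) (v w : V)
    (hg : DifferentiableAt ℝ (fun q => g (F q) (mfderiv 𝓘(ℝ, V) (AdS.I m) F q v)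
      (mfderiv 𝓘(ℝ, V) (AdS.I m) F q w)) q) :
    fderiv ℝ (fun q => g (F q) (mfderiv 𝓘(ℝ, V) (AdS.I m) F q v)
        (mfderiv 𝓘(ℝ, V) (AdS.I m) F q w)) q (coordField F G X q)
      + g (F q) (mfderiv 𝓘(ℝ, V) (AdS.I m) F q (fderiv ℝ (coordField F G X) q v))
          (mfderiv 𝓘(ℝ, V) (AdS.I m) F q w)
      + g (F q) (mfderiv 𝓘(ℝ, V) (AdS.I m) F q v)
          (mfderiv 𝓘(ℝ, V) (AdS.I m) F q (fderiv ℝ (coordField F G X) q w)) = 0 := by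
  set f : V → ℝ := fun q => g (F q) (mfderiv 𝓘(ℝ, V) (AdS.I m) F q v)
    (mfderiv 𝓘(ℝ, V) (AdS.I m) F q w) with hf
  have h1 := hK.lie_eq_zero (F q) hint (constField G v) (constField G w)
    (h.mdifferentiableAt_constField hq v) (h.mdifferentiableAt_constField hq w)
  -- near `F q`, the function `g(V, W)` is its coordinate expression `f` composed with `G`
  have h2 : (fun y => g y (constField G v y) (constField G w y)) =ᶠ[𝓝 (F q)] f ∘ G := by
    filter_upwards [h.isOpen_target.mem_nhds (h.mapsTo hq)] with y hy
    have h3 : g (F (G y)) (constField G v (F (G y))) (constField G w (F (G y))) = f (G y) := by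
      rw [h.constField_apply (h.mapsTo_symm hy), h.constField_apply (h.mapsTo_symm hy)]
    rw [h.right_inv y hy] at h3
    exact h3
  have h3 : MDifferentiableAt 𝓘(ℝ, V) 𝓘(ℝ, ℝ) f (G (F q)) := by
    rw [h.left_inv q hq]; exact hg.mdifferentiableAt
  have h4 := mfderiv_comp (F q) h3
    ((h.contMDiffAt_symm (h.mapsTo hq)).mdifferentiableAt two_ne_zero)
  have h5 : (mfderiv (AdS.I m) 𝓘(ℝ, ℝ)
      (fun y => g y (constField G v y) (constField G w y)) (F q) (X (F q)) : ℝ)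
      = fderiv ℝ f q (coordField F G X q) := by
    have h6 : ∀ p, p = q → ∀ u : V, (mfderiv 𝓘(ℝ, V) 𝓘(ℝ, ℝ) f p u : ℝ) = fderiv ℝ f q u := by
      rintro _ rfl _; rw [mfderiv_eq_fderiv]; rfl
    exact (congrArg (fun l : E m →L[ℝ] ℝ => l (X (F q))) (h2.mfderiv_eq.trans h4)).trans
      (h6 _ (h.left_inv q hq) _)
  rw [h5, h.mlieBracket_constField hq hX, h.mlieBracket_constField hq hX,
    h.constField_apply hq, h.constField_apply hq] at h1
  simp only [map_neg, neg_apply] at h1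
  have h6 : ∀ a b c : ℝ, a = -b + -c → a + b + c = 0 := fun a b c h => by linarith
  exact h6 _ _ _ h1

end IsParametrization

end Killing

/-! ### Special boundary coordinates in a chart of the sphere -/

section Chart

variable {m : ℕ} (θ₀ : Sph m)

/-- The inverse of the coordinates `(s, t, z)`, where `z` are coordinates on the sphere around
`θ₀`. -/
noncomputable def cylChartSymm (q : ℝ × BVec m) : ℝ × (ℝ × Sph m) :=
  (q.1, (q.2.1, (extChartAt (𝓡 m) θ₀).symm q.2.2))

/-- The coordinates `(s, t, z)`, where `z` are coordinates on the sphere around `θ₀`. -/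
noncomputable def cylChart (p : ℝ × (ℝ × Sph m)) : ℝ × BVec m :=
  (p.1, (p.2.1, extChartAt (𝓡 m) θ₀ p.2.2))

/-- The range of the coordinates `(t, z)`. -/
def cylTarget : Set (BVec m) := {p | p.2 ∈ (extChartAt (𝓡 m) θ₀).target}

/-- The height of a collar in the coordinates `(t, z)`. -/
noncomputable def chartEps (ε : ℝ × Sph m → ℝ) (p : BVec m) : ℝ :=
  ε (p.1, (extChartAt (𝓡 m) θ₀).symm p.2)

lemma isOpen_cylTarget : IsOpen (cylTarget θ₀) :=
  (isOpen_extChartAt_target θ₀).preimage continuous_snd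

lemma continuousOn_chartEps {ε : ℝ × Sph m → ℝ} (hε : Continuous ε) :
    ContinuousOn (chartEps θ₀ ε) (cylTarget θ₀) :=
  hε.comp_continuousOn (continuousOn_fst.prodMk
    ((continuousOn_extChartAt_symm θ₀).comp continuousOn_snd fun _ hp => hp))

lemma contMDiffOn_cylChartSymm :
    ContMDiffOn 𝓘(ℝ, ℝ × BVec m) (JC m) 2 (cylChartSymm θ₀) {q | q.2 ∈ cylTarget θ₀} := by
  have h1 : ContMDiffOn 𝓘(ℝ, ℝ × BVec m) 𝓘(ℝ, ℝ) 2 (fun q : ℝ × BVec m => q.1)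
      {q | q.2 ∈ cylTarget θ₀} := contDiff_fst.contMDiff.contMDiffOn
  have h2 : ContMDiffOn 𝓘(ℝ, ℝ × BVec m) 𝓘(ℝ, ℝ) 2 (fun q : ℝ × BVec m => q.2.1)
      {q | q.2 ∈ cylTarget θ₀} := (contDiff_fst.comp contDiff_snd).contMDiff.contMDiffOn
  have h3 : ContMDiffOn 𝓘(ℝ, ℝ × BVec m) 𝓘(ℝ, EuclideanSpace ℝ (Fin m)) 2
      (fun q : ℝ × BVec m => q.2.2)
      {q | q.2 ∈ cylTarget θ₀} := (contDiff_snd.comp contDiff_snd).contMDiff.contMDiffOn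
  exact h1.prodMk (h2.prodMk ((contMDiffOn_extChartAt_symm θ₀).comp h3 fun q hq => hq))

lemma contMDiffOn_cylChart :
    ContMDiffOn (JC m) 𝓘(ℝ, ℝ × BVec m) 2 (cylChart θ₀)
      {p | p.2.2 ∈ (extChartAt (𝓡 m) θ₀).source} := by
  have h1 : ContMDiffOn (JC m) (𝓡 m) 2 (fun p : ℝ × (ℝ × Sph m) => p.2.2)
    {p | p.2.2 ∈ (extChartAt (𝓡 m) θ₀).source} := (contMDiff_snd.comp contMDiff_snd).contMDiffOn
  have h2 := contMDiffOn_extChartAt (I := 𝓡 m) (n := 2) (x := θ₀)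
  rw [← extChartAt_source (𝓡 m)] at h2
  exact contMDiffOn_fst.prodMk_space ((contMDiff_fst.comp contMDiff_snd).contMDiffOn.prodMk_space
    (h2.comp h1 fun q hq => hq))

variable {θ₀}

/-- The derivative of `cylChartSymm`: the identity on the components `s` and `t`. -/
lemma mfderiv_cylChartSymm {q : ℝ × BVec m} (hq : q.2 ∈ cylTarget θ₀) (v : ℝ × BVec m) :
    (mfderiv 𝓘(ℝ, ℝ × BVec m) (JC m) (cylChartSymm θ₀) q v : ℝ × BVec m)
      = (v.1, (v.2.1, mfderiv (𝓘(ℝ, EuclideanSpace ℝ (Fin m))) (𝓡 m)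
          (extChartAt (𝓡 m) θ₀).symm q.2.2 v.2.2)) := by
  have hχ : MDifferentiableAt 𝓘(ℝ, EuclideanSpace ℝ (Fin m)) (𝓡 m)
      (extChartAt (𝓡 m) θ₀).symm q.2.2 :=
    ((contMDiffOn_extChartAt_symm (n := 1) θ₀).contMDiffAt
      ((isOpen_extChartAt_target θ₀).mem_nhds hq)).mdifferentiableAt one_ne_zero
  have h1 : HasMFDerivAt 𝓘(ℝ, ℝ × BVec m) 𝓘(ℝ, ℝ) (fun q : ℝ × BVec m => q.1) q
      (ContinuousLinearMap.fst ℝ ℝ (BVec m)) := hasFDerivAt_fst.hasMFDerivAt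
  have h2 : HasMFDerivAt 𝓘(ℝ, ℝ × BVec m) 𝓘(ℝ, ℝ) (fun q : ℝ × BVec m => q.2.1) q
      ((ContinuousLinearMap.fst ℝ ℝ _).comp (ContinuousLinearMap.snd ℝ ℝ (BVec m))) :=
    (hasFDerivAt_fst.comp q hasFDerivAt_snd).hasMFDerivAt
  have h3 : HasMFDerivAt 𝓘(ℝ, ℝ × BVec m) 𝓘(ℝ, EuclideanSpace ℝ (Fin m))
      (fun q : ℝ × BVec m => q.2.2) q
      ((ContinuousLinearMap.snd ℝ ℝ _).comp (ContinuousLinearMap.snd ℝ ℝ (BVec m))) :=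
    (hasFDerivAt_snd.comp q hasFDerivAt_snd).hasMFDerivAt
  have h4 := h1.prodMk (h2.prodMk (HasMFDerivAt.comp q hχ.hasMFDerivAt h3))
  exact congrArg (fun l : ℝ × BVec m →L[ℝ] ℝ × BVec m => l v) h4.mfderiv

lemma cylChartSymm_mem_collar {ε : ℝ × Sph m → ℝ} {q : ℝ × BVec m}
    (hq : q ∈ flatCollar (cylTarget θ₀) (chartEps θ₀ ε)) : cylChartSymm θ₀ q ∈ collar ε := hq.2

lemma cylChart_mem_flatCollar {ε : ℝ × Sph m → ℝ} {p : ℝ × (ℝ × Sph m)} (hp : p ∈ collar ε)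
    (hθ : p.2.2 ∈ (extChartAt (𝓡 m) θ₀).source) :
    cylChart θ₀ p ∈ flatCollar (cylTarget θ₀) (chartEps θ₀ ε) := by
  refine ⟨(extChartAt (𝓡 m) θ₀).map_source hθ, hp.1, ?_⟩
  have : chartEps θ₀ ε (cylChart θ₀ p).2 = ε p.2 := by
    simp only [chartEps, cylChart, (extChartAt (𝓡 m) θ₀).left_inv hθ]
  rw [this]; exact hp.2

lemma cylChartSymm_cylChart {p : ℝ × (ℝ × Sph m)}
    (hθ : p.2.2 ∈ (extChartAt (𝓡 m) θ₀).source) : cylChartSymm θ₀ (cylChart θ₀ p) = p := by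
  simp only [cylChartSymm, cylChart, (extChartAt (𝓡 m) θ₀).left_inv hθ]

lemma cylChart_cylChartSymm {q : ℝ × BVec m} (hq : q.2 ∈ cylTarget θ₀) :
    cylChart θ₀ (cylChartSymm θ₀ q) = q := by
  simp only [cylChartSymm, cylChart, (extChartAt (𝓡 m) θ₀).right_inv hq]

end Chart

section Special

variable {m : ℕ} {Y : Type*} [TopologicalSpace Y] [ChartedSpace (EuclideanHalfSpace (m + 2)) Y]
  [IsManifold (AdS.I m) ∞ Y] {g gbar : BilinField m Y} {ψ : ℝ × Sph m → Y} {U : Set Y} {s : Y → ℝ}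
  {ε : ℝ × Sph m → ℝ} {Φ : PartialEquiv (ℝ × (ℝ × Sph m)) Y} {θ₀ : Sph m}

/-- The special coordinates `(s, t, z)` around `θ₀`, as a map from coordinates to points. -/
noncomputable def paramMap (Φ : PartialEquiv (ℝ × (ℝ × Sph m)) Y) (θ₀ : Sph m)
    (q : ℝ × BVec m) : Y :=
  Φ (cylChartSymm θ₀ q)

/-- The special coordinates `(s, t, z)` around `θ₀`, as a map from points to coordinates. -/
noncomputable def coordMap (Φ : PartialEquiv (ℝ × (ℝ × Sph m)) Y) (θ₀ : Sph m) (y : Y) :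
    ℝ × BVec m :=
  cylChart θ₀ (Φ.symm y)

/-- The collar in the coordinates `(s, t, z)` around `θ₀`. -/
def chartCollar (ε : ℝ × Sph m → ℝ) (θ₀ : Sph m) : Set (ℝ × BVec m) :=
  flatCollar (cylTarget θ₀) (chartEps θ₀ ε)

/-- The points of the collar without its boundary face, in the coordinates around `θ₀`. -/
def chartCollarInt (ε : ℝ × Sph m → ℝ) (θ₀ : Sph m) : Set (ℝ × BVec m) :=
  openFlatCollar (cylTarget θ₀) (chartEps θ₀ ε)

/-- The set of points of `Y` covered by the special coordinates around `θ₀`. -/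
def paramTarget (Φ : PartialEquiv (ℝ × (ℝ × Sph m)) Y) (θ₀ : Sph m) : Set Y :=
  Φ.target ∩ Φ.symm ⁻¹' {p | p.2.2 ∈ (extChartAt (𝓡 m) θ₀).source}

/-- The derivative of `paramMap`, up to the boundary of the collar. -/
noncomputable def dParam (Φ : PartialEquiv (ℝ × (ℝ × Sph m)) Y) (ε : ℝ × Sph m → ℝ) (θ₀ : Sph m)
    (q : ℝ × BVec m) : ℝ × BVec m →L[ℝ] E m :=
  mfderivWithin 𝓘(ℝ, ℝ × BVec m) (AdS.I m) (paramMap Φ θ₀) (chartCollar ε θ₀) q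

/-- The components of `gbar` in the special coordinates `(s, t, z)` around `θ₀`. -/
noncomputable def coordForm (gbar : BilinField m Y) (Φ : PartialEquiv (ℝ × (ℝ × Sph m)) Y)
    (ε : ℝ × Sph m → ℝ) (θ₀ : Sph m) (q : ℝ × BVec m) :
    ℝ × BVec m →L[ℝ] ℝ × BVec m →L[ℝ] ℝ :=
  ContinuousLinearMap.bilinearComp (gbar (paramMap Φ θ₀ q) : E m →L[ℝ] E m →L[ℝ] ℝ)
    (dParam Φ ε θ₀ q) (dParam Φ ε θ₀ q)

namespace AdS.IsSpecialCoordinates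

lemma uniqueMDiffOn_chartCollar (hΦ : IsSpecialCoordinates ψ U s gbar ε Φ) :
    UniqueMDiffOn 𝓘(ℝ, ℝ × BVec m) (chartCollar ε θ₀) :=
  (uniqueDiffOn_flatCollar (isOpen_cylTarget θ₀)
    (continuousOn_chartEps θ₀ hΦ.eps_continuous)).uniqueMDiffOn

lemma isOpen_chartCollarInt (hΦ : IsSpecialCoordinates ψ U s gbar ε Φ) :
    IsOpen (chartCollarInt ε θ₀) :=
  isOpen_openFlatCollar (isOpen_cylTarget θ₀) (continuousOn_chartEps θ₀ hΦ.eps_continuous)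

lemma contMDiffOn_paramMap (hΦ : IsSpecialCoordinates ψ U s gbar ε Φ) :
    ContMDiffOn 𝓘(ℝ, ℝ × BVec m) (AdS.I m) 2 (paramMap Φ θ₀) (chartCollar ε θ₀) :=
  hΦ.contMDiffOn.comp ((contMDiffOn_cylChartSymm θ₀).mono fun _ hq => hq.1)
    fun q hq => by rw [mem_preimage, hΦ.source_eq]; exact cylChartSymm_mem_collar hq

lemma contMDiffOn_coordMap (hΦ : IsSpecialCoordinates ψ U s gbar ε Φ) :
    ContMDiffOn (AdS.I m) 𝓘(ℝ, ℝ × BVec m) 2 (coordMap Φ θ₀) (paramTarget Φ θ₀) :=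
  (contMDiffOn_cylChart θ₀).comp (hΦ.contMDiffOn_symm.mono inter_subset_left) fun _ hy => hy.2

lemma isOpen_paramTarget (hΦ : IsSpecialCoordinates ψ U s gbar ε Φ) :
    IsOpen (paramTarget Φ θ₀) :=
  hΦ.contMDiffOn_symm.continuousOn.isOpen_inter_preimage hΦ.target_open
    ((isOpen_extChartAt_source θ₀).preimage (continuous_snd.comp continuous_snd))

lemma mem_source (hΦ : IsSpecialCoordinates ψ U s gbar ε Φ) {q : ℝ × BVec m}
    (hq : q ∈ chartCollar ε θ₀) : cylChartSymm θ₀ q ∈ Φ.source := by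
  rw [hΦ.source_eq]; exact cylChartSymm_mem_collar hq

lemma mapsTo_paramMap (hΦ : IsSpecialCoordinates ψ U s gbar ε Φ) :
    MapsTo (paramMap Φ θ₀) (chartCollar ε θ₀) (paramTarget Φ θ₀) := fun q hq => by
  refine ⟨Φ.map_source (hΦ.mem_source hq), ?_⟩
  rw [mem_preimage, paramMap, Φ.left_inv (hΦ.mem_source hq)]
  exact (extChartAt (𝓡 m) θ₀).map_target hq.1

lemma mapsTo_coordMap (hΦ : IsSpecialCoordinates ψ U s gbar ε Φ) :
    MapsTo (coordMap Φ θ₀) (paramTarget Φ θ₀) (chartCollar ε θ₀) := fun y hy =>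
  cylChart_mem_flatCollar (by rw [← hΦ.source_eq]; exact Φ.map_target hy.1) hy.2

lemma coordMap_paramMap (hΦ : IsSpecialCoordinates ψ U s gbar ε Φ) {q : ℝ × BVec m}
    (hq : q ∈ chartCollar ε θ₀) : coordMap Φ θ₀ (paramMap Φ θ₀ q) = q := by
  rw [coordMap, paramMap, Φ.left_inv (hΦ.mem_source hq), cylChart_cylChartSymm hq.1]

lemma paramMap_coordMap {y : Y} (hy : y ∈ paramTarget Φ θ₀) :
    paramMap Φ θ₀ (coordMap Φ θ₀ y) = y := by
  rw [coordMap, paramMap, cylChartSymm_cylChart hy.2, Φ.right_inv hy.1]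

lemma s_paramMap (hΦ : IsSpecialCoordinates ψ U s gbar ε Φ) {q : ℝ × BVec m}
    (hq : q ∈ chartCollar ε θ₀) : s (paramMap Φ θ₀ q) = q.1 :=
  hΦ.fst_eq _ (cylChartSymm_mem_collar hq)

lemma paramMap_mem (hΦ : IsSpecialCoordinates ψ U s gbar ε Φ) {q : ℝ × BVec m}
    (hq : q ∈ chartCollar ε θ₀) : paramMap Φ θ₀ q ∈ U :=
  hΦ.target_subset (hΦ.mapsTo_paramMap hq).1

/-- Points with `s > 0` are interior points, since `s` vanishes on the boundary. -/
lemma paramMap_mem_interior (hΦ : IsSpecialCoordinates ψ U s gbar ε Φ)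
    (hs : IsSpecialDefiningFunction g ψ U s gbar) {q : ℝ × BVec m}
    (hq : q ∈ chartCollarInt ε θ₀) : paramMap Φ θ₀ q ∈ (AdS.I m).interior Y := by
  rcases (AdS.I m).isInteriorPoint_or_isBoundaryPoint (paramMap Φ θ₀ q) with h | h
  · exact h
  · have h1 := hs.defining.zero _ h
    rw [hΦ.s_paramMap (openFlatCollar_subset hq)] at h1
    exact absurd h1 hq.2.1.ne'

/-- Away from the boundary face, the special coordinates parametrize an open subset of `Y`. -/
lemma isParametrization (hΦ : IsSpecialCoordinates ψ U s gbar ε Φ) :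
    IsParametrization (m := m) (chartCollarInt ε θ₀)
      (paramTarget Φ θ₀ ∩ coordMap Φ θ₀ ⁻¹' {q | 0 < q.1}) (paramMap Φ θ₀) (coordMap Φ θ₀) where
  isOpen_source := hΦ.isOpen_chartCollarInt
  isOpen_target := hΦ.contMDiffOn_coordMap.continuousOn.isOpen_inter_preimage hΦ.isOpen_paramTarget
    (isOpen_lt continuous_const continuous_fst)
  contMDiffOn := hΦ.contMDiffOn_paramMap.mono openFlatCollar_subset
  contMDiffOn_symm := hΦ.contMDiffOn_coordMap.mono inter_subset_left
  mapsTo q hq := ⟨hΦ.mapsTo_paramMap (openFlatCollar_subset hq), by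
    rw [mem_preimage, hΦ.coordMap_paramMap (openFlatCollar_subset hq)]; exact hq.2.1⟩
  mapsTo_symm y hy := ⟨(hΦ.mapsTo_coordMap hy.1).1, hy.2, (hΦ.mapsTo_coordMap hy.1).2.2⟩
  left_inv _ hq := hΦ.coordMap_paramMap (openFlatCollar_subset hq)
  right_inv _ hy := paramMap_coordMap hy.1

lemma mdifferentiableWithinAt_paramMap (hΦ : IsSpecialCoordinates ψ U s gbar ε Φ)
    {q : ℝ × BVec m} (hq : q ∈ chartCollar ε θ₀) :
    MDifferentiableWithinAt 𝓘(ℝ, ℝ × BVec m) (AdS.I m) (paramMap Φ θ₀) (chartCollar ε θ₀) q :=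
  hΦ.contMDiffOn_paramMap.mdifferentiableOn two_ne_zero q hq

lemma dParam_eq_mfderiv (hΦ : IsSpecialCoordinates ψ U s gbar ε Φ) {q : ℝ × BVec m}
    (hq : q ∈ chartCollarInt ε θ₀) :
    dParam Φ ε θ₀ q = mfderiv 𝓘(ℝ, ℝ × BVec m) (AdS.I m) (paramMap Φ θ₀) q :=
  mfderivWithin_of_mem_nhds
    (mem_of_superset (hΦ.isOpen_chartCollarInt.mem_nhds hq) openFlatCollar_subset)

/-- The coordinate fields of `(s, t, z)` in terms of those of `(s, t, θ)`. -/
lemma dParam_apply (hΦ : IsSpecialCoordinates ψ U s gbar ε Φ) {q : ℝ × BVec m}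
    (hq : q ∈ chartCollar ε θ₀) (v : ℝ × BVec m) :
    dParam Φ ε θ₀ q v = push Φ ε (cylChartSymm θ₀ q)
      (v.1, (v.2.1, mfderiv 𝓘(ℝ, EuclideanSpace ℝ (Fin m)) (𝓡 m)
          (extChartAt (𝓡 m) θ₀).symm q.2.2 v.2.2)) := by
  have hopen : IsOpen {q : ℝ × BVec m | q.2 ∈ cylTarget θ₀} :=
    (isOpen_cylTarget θ₀).preimage continuous_snd
  have h1 : MDifferentiableWithinAt (JC m) (AdS.I m) Φ (collar ε) (cylChartSymm θ₀ q) := by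
    rw [← hΦ.source_eq]
    exact hΦ.contMDiffOn.mdifferentiableOn two_ne_zero _ (hΦ.mem_source hq)
  have h2 : MDifferentiableAt 𝓘(ℝ, ℝ × BVec m) (JC m) (cylChartSymm θ₀) q :=
    ((contMDiffOn_cylChartSymm θ₀).contMDiffAt (hopen.mem_nhds hq.1)).mdifferentiableAt two_ne_zero
  have h3 := mfderivWithin_comp q h1 h2.mdifferentiableWithinAt
    (fun q' (hq' : q' ∈ chartCollar ε θ₀) => cylChartSymm_mem_collar hq')
    (hΦ.uniqueMDiffOn_chartCollar q hq)
  rw [mfderivWithin_eq_mfderiv (hΦ.uniqueMDiffOn_chartCollar q hq) h2] at h3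
  have h4 := congrArg (fun l : ℝ × BVec m →L[ℝ] E m => l v) h3
  refine h4.trans ?_
  exact congrArg (fun u : ℝ × BVec m => (push Φ ε (cylChartSymm θ₀ q) u : E m))
    (mfderiv_cylChartSymm hq.1 v)

lemma dParam_dt (hΦ : IsSpecialCoordinates ψ U s gbar ε Φ) {q : ℝ × BVec m}
    (hq : q ∈ chartCollar ε θ₀) :
    dParam Φ ε θ₀ q (0, (1, 0)) = push Φ ε (cylChartSymm θ₀ q) (0, (1, 0)) := by
  rw [hΦ.dParam_apply hq]
  exact congrArg (fun z : EuclideanSpace ℝ (Fin m) =>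
    (push Φ ε (cylChartSymm θ₀ q) (0, (1, z)) : E m)) (map_zero (mfderiv
      𝓘(ℝ, EuclideanSpace ℝ (Fin m)) (𝓡 m) (extChartAt (𝓡 m) θ₀).symm q.2.2 :
      EuclideanSpace ℝ (Fin m) →L[ℝ] EuclideanSpace ℝ (Fin m)))

/-- `d coordMap ∘ d paramMap = id` holds up to the boundary, where `dParam` is one-sided. -/
lemma mfderiv_coordMap_dParam (hΦ : IsSpecialCoordinates ψ U s gbar ε Φ) {q : ℝ × BVec m}
    (hq : q ∈ chartCollar ε θ₀) (v : ℝ × BVec m) :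
    (mfderiv (AdS.I m) 𝓘(ℝ, ℝ × BVec m) (coordMap Φ θ₀) (paramMap Φ θ₀ q) (dParam Φ ε θ₀ q v) :
      ℝ × BVec m) = v := by
  have h1 : MDifferentiableAt (AdS.I m) 𝓘(ℝ, ℝ × BVec m) (coordMap Φ θ₀) (paramMap Φ θ₀ q) :=
    (hΦ.contMDiffOn_coordMap.contMDiffAt
      (hΦ.isOpen_paramTarget.mem_nhds (hΦ.mapsTo_paramMap hq))).mdifferentiableAt two_ne_zero
  have hu := hΦ.uniqueMDiffOn_chartCollar q hq
  have h2 := mfderiv_comp_mfderivWithin q h1 (hΦ.mdifferentiableWithinAt_paramMap hq) hu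
  have h3 : mfderivWithin 𝓘(ℝ, ℝ × BVec m) 𝓘(ℝ, ℝ × BVec m) (coordMap Φ θ₀ ∘ paramMap Φ θ₀)
      (chartCollar ε θ₀) q = mfderivWithin 𝓘(ℝ, ℝ × BVec m) 𝓘(ℝ, ℝ × BVec m) id
      (chartCollar ε θ₀) q :=
    mfderivWithin_congr (fun q' hq' => hΦ.coordMap_paramMap hq') (hΦ.coordMap_paramMap hq)
  exact congrArg (fun l : ℝ × BVec m →L[ℝ] ℝ × BVec m => l v)
    (h2.symm.trans (h3.trans (mfderivWithin_id hu)))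

/-- On the boundary, the coordinate fields tangent to it are the images of those of `ℝ × S^m` under
`dψ`. -/
lemma push_zero (hΦ : IsSpecialCoordinates ψ U s gbar ε Φ) (p : ℝ × Sph m) (v : BVec m) :
    (push Φ ε (0, p) (0, v) : E m) = mfderiv (J m) (AdS.I m) ψ p v := by
  have hmem : ∀ p : ℝ × Sph m, ((0 : ℝ), p) ∈ collar ε := fun p => ⟨le_rfl, hΦ.eps_pos p⟩
  have h1 : MDifferentiableWithinAt (JC m) (AdS.I m) Φ (collar ε) (0, p) := by
    rw [← hΦ.source_eq]
    exact hΦ.contMDiffOn.mdifferentiableOn two_ne_zero _ (by rw [hΦ.source_eq]; exact hmem p)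
  have h2 : HasMFDerivAt (J m) (JC m) (fun p : ℝ × Sph m => ((0 : ℝ), p)) p
      (ContinuousLinearMap.inr ℝ ℝ (BVec m)) := by
    exact (hasMFDerivAt_const (0 : ℝ) p).prodMk (hasMFDerivAt_id p)
  have h3 := h1.hasMFDerivWithinAt.comp p (h2.hasMFDerivWithinAt (s := univ))
    (fun p' _ => hmem p')
  rw [hasMFDerivWithinAt_univ] at h3
  have h4 : (Φ ∘ fun p : ℝ × Sph m => ((0 : ℝ), p)) = ψ := funext hΦ.boundary_eq
  rw [h4] at h3
  exact (congrArg (fun l : BVec m →L[ℝ] E m => l v) h3.mfderiv).symm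

end AdS.IsSpecialCoordinates
end Special

/-! ### Regularity and boundary behaviour in special coordinates -/

section Lorentz

variable {V : Type*} [AddCommGroup V] [Module ℝ V] [TopologicalSpace V] [IsTopologicalAddGroup V]
  [ContinuousConstSMul ℝ V] {B : V →L[ℝ] V →L[ℝ] ℝ}

/-- A Lorentzian form is nondegenerate. -/
lemma AdS.IsLorentz.eq_zero (hB : IsLorentz B) {u : V} (hu : ∀ w, B u w = 0) : u = 0 := by
  obtain ⟨hsymm, v, -, hv⟩ := hB
  by_contra hne
  exact (hv u (by rw [hsymm]; exact hu v) hne).ne' (hu u)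

end Lorentz

section Special

variable {m : ℕ} {Y : Type*} [TopologicalSpace Y] [ChartedSpace (EuclideanHalfSpace (m + 2)) Y]
  [IsManifold (AdS.I m) ∞ Y] {g gbar : BilinField m Y} {ψ : ℝ × Sph m → Y} {U : Set Y} {s : Y → ℝ}
  {ε : ℝ × Sph m → ℝ} {Φ : PartialEquiv (ℝ × (ℝ × Sph m)) Y} {θ₀ : Sph m}
  {X : ∀ x : Y, TangentSpace (AdS.I m) x}

namespace AdS.IsSpecialCoordinates

/-- The coordinate fields are of class `C^1` up to the boundary, as the coordinates are `C^2`. -/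
lemma contMDiffOn_dParam (hΦ : IsSpecialCoordinates ψ U s gbar ε Φ) (v : ℝ × BVec m) :
    ContMDiffOn 𝓘(ℝ, ℝ × BVec m) (AdS.I m).tangent 1
      (fun q => (⟨paramMap Φ θ₀ q, dParam Φ ε θ₀ q v⟩ : TangentBundle (AdS.I m) Y))
      (chartCollar ε θ₀) := by
  have h1 := hΦ.contMDiffOn_paramMap.contMDiffOn_tangentMapWithin (m := 1)
    (by norm_num) (hΦ.uniqueMDiffOn_chartCollar (θ₀ := θ₀))
  have h2 : ContMDiff 𝓘(ℝ, ℝ × BVec m) 𝓘(ℝ, ℝ × BVec m).tangent 1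
      (fun q => (⟨q, v⟩ : TangentBundle 𝓘(ℝ, ℝ × BVec m) (ℝ × BVec m))) :=
    contMDiff_vectorSpace_iff_contDiff.2 contDiff_const
  exact h1.comp h2.contMDiffOn fun q hq => hq

lemma contDiffOn_coordForm (hΦ : IsSpecialCoordinates ψ U s gbar ε Φ)
    (hs : IsSpecialDefiningFunction g ψ U s gbar) :
    ContDiffOn ℝ 1 (coordForm gbar Φ ε θ₀) (chartCollar ε θ₀) := by
  refine contDiffOn_clm_apply.2 fun v => contDiffOn_clm_apply.2 fun w => ?_
  have h1 : ContMDiffOn 𝓘(ℝ, ℝ × BVec m) ((AdS.I m).prod 𝓘(ℝ, E m →L[ℝ] E m →L[ℝ] ℝ)) 1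
      (fun q => Bundle.TotalSpace.mk' (E m →L[ℝ] E m →L[ℝ] ℝ)
        (E := fun x : Y => TangentSpace (AdS.I m) x →L[ℝ] TangentSpace (AdS.I m) x →L[ℝ] ℝ)
        (paramMap Φ θ₀ q) (gbar (paramMap Φ θ₀ q))) (chartCollar ε θ₀) :=
    ContMDiffOn.comp hs.extension.ck (hΦ.contMDiffOn_paramMap.of_le (by norm_num))
      fun q hq => hΦ.paramMap_mem hq
  have h2 : ContMDiffOn 𝓘(ℝ, ℝ × BVec m) ((AdS.I m).prod 𝓘(ℝ, ℝ)) 1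
      (fun q => Bundle.TotalSpace.mk' ℝ (E := Bundle.Trivial Y ℝ) (paramMap Φ θ₀ q)
        (gbar (paramMap Φ θ₀ q) (dParam Φ ε θ₀ q v) (dParam Φ ε θ₀ q w)))
      (chartCollar ε θ₀) :=
    fun q hq => ContMDiffWithinAt.clm_bundle_apply₂ (F₁ := E m) (F₂ := E m) (h1 q hq)
      (hΦ.contMDiffOn_dParam v q hq) (hΦ.contMDiffOn_dParam w q hq)
  intro q hq
  have h3 := h2 q hq
  simp only [Bundle.contMDiffWithinAt_totalSpace] at h3
  exact contMDiffWithinAt_iff_contDiffWithinAt.1 h3.2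

lemma mdifferentiableAt_field (hΦ : IsSpecialCoordinates ψ U s gbar ε Φ)
    (hs : IsSpecialDefiningFunction g ψ U s gbar) (hX : IsKillingField g X) {q : ℝ × BVec m}
    (hq : q ∈ chartCollarInt ε θ₀) :
    MDifferentiableAt (AdS.I m) (AdS.I m).tangent
      (fun y => (⟨y, X y⟩ : TangentBundle (AdS.I m) Y)) (paramMap Φ θ₀ q) := by
  have h1 := hX.contMDiffOn.mdifferentiableOn one_ne_zero _ (hΦ.paramMap_mem_interior hs hq)
  refine h1.mdifferentiableAt ?_
  have hP := hΦ.isParametrization (θ₀ := θ₀)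
  refine mem_of_superset (hP.isOpen_target.mem_nhds (hP.mapsTo hq)) fun y hy => ?_
  rw [← hP.right_inv y hy]
  exact hΦ.paramMap_mem_interior hs (hP.mapsTo_symm hy)

/-- In components, `X` tends to `∂_t` at the boundary: apply the continuous tangent map of
`coordMap` to the convergence in the tangent bundle. -/
lemma tendsto_coordField (hΦ : IsSpecialCoordinates ψ U s gbar ε Φ)
    (hs : IsSpecialDefiningFunction g ψ U s gbar) (hX : ApproachesTimeTranslation ψ X)
    {p : BVec m} (hp : p ∈ cylTarget θ₀) :
    Tendsto (coordField (paramMap Φ θ₀) (coordMap Φ θ₀) X) (𝓝[chartCollarInt ε θ₀] (0, p))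
      (𝓝 (0, (1, 0))) := by
  have h0 : ((0 : ℝ), p) ∈ chartCollar ε θ₀ := ⟨hp, le_rfl, hΦ.eps_pos _⟩
  set p' : ℝ × Sph m := (cylChartSymm θ₀ ((0 : ℝ), p)).2 with hp'
  have hψ : paramMap Φ θ₀ (0, p) = ψ p' := hΦ.boundary_eq p'
  have h1 : Tendsto (paramMap Φ θ₀) (𝓝[chartCollarInt ε θ₀] (0, p))
      (𝓝[(AdS.I m).interior Y] (ψ p')) := by
    rw [← hψ]
    refine tendsto_nhdsWithin_iff.2 ⟨?_, ?_⟩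
    · exact (hΦ.contMDiffOn_paramMap.continuousOn _ h0).tendsto.mono_left
        (nhdsWithin_mono _ openFlatCollar_subset)
    · filter_upwards [self_mem_nhdsWithin] with q hq using hΦ.paramMap_mem_interior hs hq
  have h2 := (hX p').comp h1
  have hT := hΦ.isOpen_paramTarget (θ₀ := θ₀)
  have hmem : ψ p' ∈ paramTarget Φ θ₀ := hψ ▸ hΦ.mapsTo_paramMap h0
  have h3 : ContinuousAt (tangentMapWithin (AdS.I m) 𝓘(ℝ, ℝ × BVec m) (coordMap Φ θ₀)
      (paramTarget Φ θ₀)) ⟨ψ p', mfderiv (J m) (AdS.I m) ψ p' ((1, 0) : BVec m)⟩ :=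
    (hΦ.contMDiffOn_coordMap.continuousOn_tangentMapWithin (by norm_num)
      hT.uniqueMDiffOn).continuousAt
      ((hT.preimage (FiberBundle.continuous_proj (E m) (TangentSpace (AdS.I m)))).mem_nhds hmem)
  have h4 := ((contMDiff_snd_tangentBundle_modelSpace (ℝ × BVec m)
    𝓘(ℝ, ℝ × BVec m) (n := 0)).continuous.tendsto _).comp (h3.tendsto.comp h2)
  have hval : ∀ (y : Y) (u : E m), y ∈ paramTarget Φ θ₀ →
      (mfderivWithin (AdS.I m) 𝓘(ℝ, ℝ × BVec m) (coordMap Φ θ₀) (paramTarget Φ θ₀) y u : ℝ × BVec m)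
        = mfderiv (AdS.I m) 𝓘(ℝ, ℝ × BVec m) (coordMap Φ θ₀) y u := fun y u hy => by
    rw [mfderivWithin_of_isOpen hT hy]
  have h5 : (mfderivWithin (AdS.I m) 𝓘(ℝ, ℝ × BVec m) (coordMap Φ θ₀) (paramTarget Φ θ₀) (ψ p')
      (mfderiv (J m) (AdS.I m) ψ p' ((1, 0) : BVec m)) : ℝ × BVec m) = (0, (1, 0)) := by
    have h6 := hΦ.mfderiv_coordMap_dParam h0 (0, (1, 0))
    have h7 : dParam Φ ε θ₀ (0, p) (0, (1, 0)) = mfderiv (J m) (AdS.I m) ψ p' ((1, 0) : BVec m) :=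
      (hΦ.dParam_dt h0).trans (hΦ.push_zero p' (1, 0))
    have h8 : ∀ y, y = ψ p' → (mfderiv (AdS.I m) 𝓘(ℝ, ℝ × BVec m) (coordMap Φ θ₀) y
        (dParam Φ ε θ₀ (0, p) (0, (1, 0)) : E m) : ℝ × BVec m) =
        mfderiv (AdS.I m) 𝓘(ℝ, ℝ × BVec m) (coordMap Φ θ₀) (ψ p')
        (dParam Φ ε θ₀ (0, p) (0, (1, 0)) : E m) := by rintro _ rfl; rfl
    refine (hval _ _ hmem).trans ?_
    refine Eq.trans ?_ ((h8 _ hψ).symm.trans h6)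
    exact congrArg (fun u : E m => (mfderiv (AdS.I m) 𝓘(ℝ, ℝ × BVec m) (coordMap Φ θ₀) (ψ p') u :
      ℝ × BVec m)) h7.symm
  have h6 : Tendsto (fun q => (mfderivWithin (AdS.I m) 𝓘(ℝ, ℝ × BVec m) (coordMap Φ θ₀)
      (paramTarget Φ θ₀) (paramMap Φ θ₀ q) (X (paramMap Φ θ₀ q)) : ℝ × BVec m))
      (𝓝[chartCollarInt ε θ₀] (0, p)) (𝓝 (0, (1, 0))) := by
    rw [← h5]; exact h4
  refine h6.congr' ?_
  filter_upwards [self_mem_nhdsWithin] with q hq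
  exact hval _ _ (hΦ.mapsTo_paramMap (openFlatCollar_subset hq))

lemma coordForm_apply (q v w : ℝ × BVec m) : coordForm gbar Φ ε θ₀ q v w
    = gbar (paramMap Φ θ₀ q) (dParam Φ ε θ₀ q v) (dParam Φ ε θ₀ q w) := rfl

/-- The Killing equation for `g = s⁻² gbar` in terms of `gbar`. -/
lemma killing_coordForm (hΦ : IsSpecialCoordinates ψ U s gbar ε Φ)
    (hs : IsSpecialDefiningFunction g ψ U s gbar) (hX : IsKillingField g X) {q : ℝ × BVec m}
    (hq : q ∈ chartCollarInt ε θ₀) (v w : ℝ × BVec m) :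
    fderiv ℝ (coordForm gbar Φ ε θ₀) q (coordField (paramMap Φ θ₀) (coordMap Φ θ₀) X q) v w
      + coordForm gbar Φ ε θ₀ q
          (fderiv ℝ (coordField (paramMap Φ θ₀) (coordMap Φ θ₀) X) q v) w
      + coordForm gbar Φ ε θ₀ q v
          (fderiv ℝ (coordField (paramMap Φ θ₀) (coordMap Φ θ₀) X) q w)
      = 2 * ((coordField (paramMap Φ θ₀) (coordMap Φ θ₀) X q).1 / q.1)
        * coordForm gbar Φ ε θ₀ q v w := by
  have hP := hΦ.isParametrization (θ₀ := θ₀)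
  have hB : DifferentiableAt ℝ (coordForm gbar Φ ε θ₀) q :=
    ((hΦ.contDiffOn_coordForm hs).differentiableOn one_ne_zero q
      (openFlatCollar_subset hq)).differentiableAt
      (mem_of_superset (hΦ.isOpen_chartCollarInt.mem_nhds hq) openFlatCollar_subset)
  have hmul : ∀ q' ∈ chartCollarInt ε θ₀, ∀ v w : ℝ × BVec m, coordForm gbar Φ ε θ₀ q' v w
      = q'.1 ^ 2 * g (paramMap Φ θ₀ q')
        (mfderiv 𝓘(ℝ, ℝ × BVec m) (AdS.I m) (paramMap Φ θ₀) q' v)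
        (mfderiv 𝓘(ℝ, ℝ × BVec m) (AdS.I m) (paramMap Φ θ₀) q' w) := by
    intro q' hq' v w
    rw [coordForm_apply, hs.extension.eq _ ⟨hΦ.paramMap_mem (openFlatCollar_subset hq'),
      hΦ.paramMap_mem_interior hs hq'⟩, hΦ.s_paramMap (openFlatCollar_subset hq'),
      hΦ.dParam_eq_mfderiv hq']
    rfl
  -- `f` is the component `g(v, w)`, so that the component `gbar(v, w)` is `s² f`
  set f : ℝ × BVec m → ℝ := fun q => g (paramMap Φ θ₀ q)
    (mfderiv 𝓘(ℝ, ℝ × BVec m) (AdS.I m) (paramMap Φ θ₀) q v)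
    (mfderiv 𝓘(ℝ, ℝ × BVec m) (AdS.I m) (paramMap Φ θ₀) q w) with hf
  have hq0 : q.1 ≠ 0 := hq.2.1.ne'
  have hBvw : DifferentiableAt ℝ (fun q => coordForm gbar Φ ε θ₀ q v w) q :=
    (hB.clm_apply (differentiableAt_const v)).clm_apply (differentiableAt_const w)
  have hs2 : HasFDerivAt (fun q : ℝ × BVec m => q.1 ^ 2)
      ((2 * q.1) • ContinuousLinearMap.fst ℝ ℝ (BVec m)) q := by
    simpa using (hasFDerivAt_fst (𝕜 := ℝ) (p := q)).pow 2
  have hfd : DifferentiableAt ℝ f q := by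
    have h1 : f =ᶠ[𝓝 q] fun q => (q.1 ^ 2)⁻¹ * coordForm gbar Φ ε θ₀ q v w := by
      filter_upwards [hΦ.isOpen_chartCollarInt.mem_nhds hq] with q' hq'
      rw [hmul q' hq' v w, inv_mul_cancel_left₀ (pow_ne_zero 2 hq'.2.1.ne')]
    refine DifferentiableAt.congr_of_eventuallyEq ?_ h1
    exact (hs2.differentiableAt.fun_inv (pow_ne_zero 2 hq0)).fun_mul hBvw
  have hK := hP.killing_eq hq hX (hΦ.paramMap_mem_interior hs hq)
    (hΦ.mdifferentiableAt_field hs hX hq) v w hfd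
  have h2 : (fun q => coordForm gbar Φ ε θ₀ q v w) =ᶠ[𝓝 q] fun q => q.1 ^ 2 * f q := by
    filter_upwards [hΦ.isOpen_chartCollarInt.mem_nhds hq] with q' hq' using hmul q' hq' v w
  have h3 := h2.fderiv_eq.trans (hs2.mul hfd.hasFDerivAt).fderiv
  set u := coordField (paramMap Φ θ₀) (coordMap Φ θ₀) X with hu
  have h4 : fderiv ℝ (coordForm gbar Φ ε θ₀) q (u q) v w
      = q.1 ^ 2 * fderiv ℝ f q (u q) + f q * (2 * q.1 * (u q).1) := by
    rw [← fderiv_form_apply hB, h3]; rfl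
  have h5 : 2 * ((u q).1 / q.1) * (q.1 ^ 2 * f q) = f q * (2 * q.1 * (u q).1) := by
    field_simp
  have h6 : ∀ a b c d : ℝ, a + b + c = 0 → q.1 ^ 2 * a + d + q.1 ^ 2 * b + q.1 ^ 2 * c = d :=
    fun a b c d h => by linear_combination q.1 ^ 2 * h
  rw [h4, hmul q hq, hmul q hq, hmul q hq]
  exact (h6 _ _ _ _ hK).trans h5.symm

/-- On the boundary, the slice metric is the metric of the static cylinder. -/
lemma sliceMetric_zero (hΦ : IsSpecialCoordinates ψ U s gbar ε Φ)
    (hs : IsSpecialDefiningFunction g ψ U s gbar) (p : ℝ × Sph m) (v w : BVec m) :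
    sliceMetric gbar Φ ε (0, p) v w = g0 p v w := by
  have h1 : ∀ y, y = ψ p → ∀ a b : E m, (gbar y a b : ℝ) = gbar (ψ p) a b := by
    rintro _ rfl _ _; rfl
  rw [← hs.boundary_metric p v w]
  refine (h1 _ (hΦ.boundary_eq p) _ _).trans ?_
  rw [hΦ.push_zero, hΦ.push_zero]
  rfl

/-- The restriction of `coordForm` to the slices of constant `s` is the slice metric. -/
lemma coordForm_slice (hΦ : IsSpecialCoordinates ψ U s gbar ε Φ) {q : ℝ × BVec m}
    (hq : q ∈ chartCollar ε θ₀) (v w : BVec m) :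
    coordForm gbar Φ ε θ₀ q (0, v) (0, w) = sliceMetric gbar Φ ε (cylChartSymm θ₀ q)
      (v.1, mfderiv 𝓘(ℝ, EuclideanSpace ℝ (Fin m)) (𝓡 m) (extChartAt (𝓡 m) θ₀).symm q.2.2 v.2)
      (w.1, mfderiv 𝓘(ℝ, EuclideanSpace ℝ (Fin m)) (𝓡 m) (extChartAt (𝓡 m) θ₀).symm q.2.2 w.2) := by
  simp only [coordForm_apply, hΦ.dParam_apply hq]
  rfl

/-- In special coordinates around any `θ₀`, `gbar` and `X` satisfy the hypotheses of the rigidity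
theorem on a collar. -/
lemma isCollarKilling (hΦ : IsSpecialCoordinates ψ U s gbar ε Φ)
    (hs : IsSpecialDefiningFunction g ψ U s gbar) (hX : IsKillingField g X)
    (hX_inf : ApproachesTimeTranslation ψ X) :
    IsCollarKilling (cylTarget θ₀) (chartEps θ₀ ε) (coordForm gbar Φ ε θ₀)
      (coordField (paramMap Φ θ₀) (coordMap Φ θ₀) X) where
  isOpen := isOpen_cylTarget θ₀
  eps_cont := continuousOn_chartEps θ₀ hΦ.eps_continuous
  eps_pos _ _ := hΦ.eps_pos _
  contDiffOn := hΦ.contDiffOn_coordForm hs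
  normal_form q hq v w := by
    simp only [coordForm_apply, hΦ.dParam_apply hq]
    have h1 := hΦ.metric_eq _ (cylChartSymm_mem_collar hq)
    exact h1 _ _
  symm q hq v w := (hs.extension.lorentz _ (hΦ.paramMap_mem hq)).1 _ _
  nondegenerate q hq v hv := by
    have hP := hΦ.isParametrization (θ₀ := θ₀)
    have hq' := openFlatCollar_subset hq
    have h1 : dParam Φ ε θ₀ q v = 0 := by
      refine (hs.extension.lorentz _ (hΦ.paramMap_mem hq')).eq_zero fun u => ?_
      have h2 : gbar (paramMap Φ θ₀ q) (dParam Φ ε θ₀ q v) (dParam Φ ε θ₀ q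
        (mfderiv (AdS.I m) 𝓘(ℝ, ℝ × BVec m) (coordMap Φ θ₀) (paramMap Φ θ₀ q) u)) = 0 := hv _
      have h3 := congrArg (fun l : E m →L[ℝ] E m => l u) (hP.mfderiv_comp_symm hq)
      have h4 : (dParam Φ ε θ₀ q (mfderiv (AdS.I m) 𝓘(ℝ, ℝ × BVec m) (coordMap Φ θ₀)
          (paramMap Φ θ₀ q) u) : E m) = u := by
        rw [hΦ.dParam_eq_mfderiv hq]; exact h3
      rw [h4] at h2
      exact h2
    rw [← hΦ.mfderiv_coordMap_dParam hq' v, h1]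
    exact map_zero (mfderiv (AdS.I m) 𝓘(ℝ, ℝ × BVec m) (coordMap Φ θ₀) (paramMap Φ θ₀ q) :
      E m →L[ℝ] ℝ × BVec m)
  boundary p hp := by
    have h0 : ((0 : ℝ), p) ∈ chartCollar ε θ₀ := ⟨hp, le_rfl, hΦ.eps_pos _⟩
    have h1 : coordForm gbar Φ ε θ₀ (0, p) (0, (1, 0)) (0, (1, 0))
        = sliceMetric gbar Φ ε (cylChartSymm θ₀ (0, p)) (1, 0) (1, 0) := by
      simp only [coordForm_apply, hΦ.dParam_dt h0]
      rfl
    rw [h1]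
    refine (hΦ.sliceMetric_zero hs _ _ _).trans ?_
    simp [g0]
  differentiableAt q hq := hΦ.isParametrization.differentiableAt_coordField hq
    (hΦ.mdifferentiableAt_field hs hX hq)
  killing q hq v w := hΦ.killing_coordForm hs hX hq v w
  tendsto p hp := hΦ.tendsto_coordField hs hX_inf hp

end AdS.IsSpecialCoordinates

end Special

/-! ### Rigidity of the time translation near the boundary -/

theorem lemma2p4 {m : ℕ} {Y : Type*} [TopologicalSpace Y]
    [ChartedSpace (EuclideanHalfSpace (m + 2)) Y] [IsManifold (AdS.I m) ∞ Y]
    (k : ℕ∞) (hk : 2 ≤ k) (κ : ℝ) (hκ : 0 < κ)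
    (g : BilinField m Y) (hg : IsAsymptoticallyAdS k κ g)
    (ψ : ℝ × Sph m → Y) (hψ : IsBoundaryIdentification 1 ψ)
    (U : Set Y) (s : Y → ℝ) (gbar : BilinField m Y)
    (hs : IsSpecialDefiningFunction g ψ U s gbar)
    (ε : ℝ × Sph m → ℝ) (Φ : PartialEquiv (ℝ × (ℝ × Sph m)) Y)
    (hΦ : IsSpecialCoordinates ψ U s gbar ε Φ)
    (X : ∀ x : Y, TangentSpace (AdS.I m) x) (hX : IsKillingField g X)
    (hX_inf : ApproachesTimeTranslation ψ X) :
    (∀ q ∈ collar ε, 0 < q.1 → X (Φ q) = push Φ ε q (0, (1, 0))) ∧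
    (∀ (σ t t' : ℝ) (θ : Sph m), (∀ τ ∈ Set.uIcc t t', (σ, (τ, θ)) ∈ collar ε) →
      ∀ v w : BVec m,
        sliceMetric gbar Φ ε (σ, (t, θ)) v w = sliceMetric gbar Φ ε (σ, (t', θ)) v w) := by
  constructor
  · intro q hq hq0
    have hθ : q.2.2 ∈ (extChartAt (𝓡 m) q.2.2).source := mem_extChartAt_source _
    obtain ⟨θ₀, q', rfl, hq'⟩ :
        ∃ θ₀ q', cylChartSymm θ₀ q' = q ∧ q' ∈ chartCollarInt ε θ₀ :=
      ⟨q.2.2, cylChart q.2.2 q, cylChartSymm_cylChart hθ, (cylChart_mem_flatCollar hq hθ).1, hq0,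
        (cylChart_mem_flatCollar hq hθ).2.2⟩
    have h1 := (hΦ.isCollarKilling (θ₀ := θ₀) hs hX hX_inf).eq_dt hq'
    have h2 : (mfderiv 𝓘(ℝ, ℝ × BVec m) (AdS.I m) (paramMap Φ θ₀) q'
        (coordField (V := ℝ × BVec m) (paramMap Φ θ₀) (coordMap Φ θ₀) X q') : E m)
        = X (paramMap Φ θ₀ q') :=
      hΦ.isParametrization.mfderiv_coordField hq'
    rw [h1, ← hΦ.dParam_eq_mfderiv hq'] at h2
    exact h2.symm.trans (hΦ.dParam_dt (openFlatCollar_subset hq'))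
  · intro σ t t' θ hseg v w
    have hθ : θ ∈ (extChartAt (𝓡 m) θ).source := mem_extChartAt_source _
    rcases (hseg t left_mem_uIcc).1.eq_or_lt with h0 | h0
    · dsimp only at h0
      subst h0
      -- `g0` does not involve `t`
      exact (hΦ.sliceMetric_zero hs (t, θ) v w).trans (hΦ.sliceMetric_zero hs (t', θ) v w).symm
    · set z := extChartAt (𝓡 m) θ θ with hz
      have hmem : ∀ τ ∈ uIcc t t', (σ, (τ, z)) ∈ chartCollarInt ε θ := fun τ hτ =>
        have h1 := cylChart_mem_flatCollar (hseg τ hτ) hθ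
        ⟨h1.1, h0, h1.2.2⟩
      -- `L` identifies tangent vectors of the sphere at `θ` with their components in the chart
      obtain ⟨L, hL⟩ : (mfderiv 𝓘(ℝ, EuclideanSpace ℝ (Fin m)) (𝓡 m)
          (extChartAt (𝓡 m) θ).symm z).IsInvertible := by
        have h1 := isInvertible_mfderivWithin_extChartAt_symm (I := 𝓡 m)
          ((extChartAt (𝓡 m) θ).map_source hθ)
        rwa [ModelWithCorners.range_eq_univ, mfderivWithin_univ] at h1
      have hslice : ∀ τ ∈ uIcc t t', sliceMetric gbar Φ ε (σ, (τ, θ)) v w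
          = coordForm gbar Φ ε θ (σ, (τ, z)) (0, (v.1, L.symm v.2)) (0, (w.1, L.symm w.2)) := by
        intro τ hτ
        have h1 := hΦ.coordForm_slice (openFlatCollar_subset (hmem τ hτ))
          (v.1, L.symm v.2) (w.1, L.symm w.2)
        have h2 : cylChartSymm θ (σ, (τ, z)) = (σ, (τ, θ)) :=
          cylChartSymm_cylChart (p := (σ, (τ, θ))) hθ
        have h3 : ∀ u : EuclideanSpace ℝ (Fin m), (mfderiv 𝓘(ℝ, EuclideanSpace ℝ (Fin m)) (𝓡 m)
            (extChartAt (𝓡 m) θ).symm z (L.symm u) : EuclideanSpace ℝ (Fin m)) = u := by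
          intro u
          rw [← hL]; exact L.apply_symm_apply u
        rw [h2] at h1
        refine Eq.trans ?_ h1.symm
        exact congrArg₂ (fun a b : EuclideanSpace ℝ (Fin m) =>
          sliceMetric gbar Φ ε (σ, (τ, θ)) (v.1, a) (w.1, b)) (h3 v.2).symm (h3 w.2).symm
      rw [hslice t left_mem_uIcc, hslice t' right_mem_uIcc]
      exact (hΦ.isCollarKilling hs hX hX_inf).form_eq hmem _ _
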